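/- **Setting.** Let $\mathcal C=\operatorname{clos} c_{\mathcal O}=S^2\,\dot\cup\,c_{\mathcal O}$ be a finite regular cell complex which is the closure of a single 3-cell, and view its boundary 2-sphere $S^2$ from outside. $\mathcal C$ is a *3-cell template* if: 1. the 1-skeleton $\mathcal C^1$ has a bipolar orientation (no directed cycles, a single source vertex $\mathbf N$, a single sink vertex $\mathbf S$) and two directed paths $\mathbf{WE},\mathbf{EW}$ (meridians) from $\mathbf N$ to $\mathbf S$, disjoint except for $\mathbf N,\mathbf S$. The meridians decompose $S^2$ into the open hemispheres $\mathbf W$ (to the right of $\mathbf{WE}$) and $\mathbf E$ (to the left of $\mathbf{WE}$); 2. at end points on the meridians other than $\mathbf N,\mathbf S$, edges in $\mathbf W$ are directed towards the meridian and edges in $\mathbf E$ away from it; 3. let $\mathbf{NE}$, $\mathbf{NW}$ be the faces in $\mathbf W$ adjacent to the first edge of $\mathbf{WE}$, $\mathbf{EW}$, and let $\mathbf{SW}$, $\mathbf{SE}$ be the faces in $\mathbf E$ adjacent to the last edge of $\mathbf{WE}$, $\mathbf{EW}$, respectively. Then $\partial\mathbf{NE}$ and $\partial\mathbf{SW}$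 share an edge of $\mathbf{WE}$, and $\partial\mathbf{NW}$ and $\partial\mathbf{SE}$ share an edge of $\mathbf{EW}$. The *dual* $\mathcal C^{2,*}$ of $S^2$ has the faces of $S^2$ as vertices, and the vertices of $S^2$ as faces. Its edges are the edges $e^*$ which cross each edge $e$ of $S^2$ from left to right, joining the two faces adjacent to $e$. Let $w_-^0,w_-^1,w_+^0,w_+^1$ be the dual vertices of $\mathbf{NE},\mathbf{NW},\mathbf{SE},\mathbf{SW}$, respectively. The *cores* $\mathbf W^*,\mathbf E^*$ consist of the duals of all cells in the open hemispheres $\mathbf W$, $\mathbf E$. The *meridian duals* $\mathbf{WE}^*,\mathbf{EW}^*$ consist of the duals of all meridian edges and nonpolar meridian vertices. The *polar circles* are the boundaries $\partial\mathbf N^*,\partial\mathbf S^*$ of the dual faces of $\mathbf N$, $\mathbf S$. The *polar segments* are $w_-^0w_-^1=\mathbf W^*\cap\partial\mathbf N^*$ and $w_+^0w_+^1=\mathbf E^*\cap\partial\mathbf S^*$. Write $|\cdot|$ for the number of edges. **Corollary 5.2.** In the dual $\mathcal C^{2,*}$ of the boundary sphere of any 3-cell template, the following hold. (i) $\partial\mathbf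 N^*$ and $\partial\mathbf S^*$ share an edge if, and only if, the distance of $\mathbf N$ and $\mathbf S$ in $\mathcal C^1$ is $1$. (ii) The 1-skeletons of the cores $\mathbf W^*$ and $\mathbf E^*$ are bipolar, from the North poles $w_-^0$ and $w_+^0$ to the South poles $w_-^1$ and $w_+^1$, respectively. Moreover $w_-^0=w_-^1$ if, and only if, $\mathbf W^*=\{w_-^0\}=\{w_-^1\}$ is a singleton; likewise $w_+^0=w_+^1$ if, and only if, $\mathbf E^*=\{w_+^0\}=\{w_+^1\}$. (iii) The edge distance between $\partial\mathbf N^*$ and $\partial\mathbf S^*$ is at most $1$. We have $w_-^0,w_-^1\in\partial\mathbf N^*$ and $w_+^0,w_+^1\in\partial\mathbf S^*$, and there are at least two distinct directed single-edge bridges between the polar circles: one in $\mathbf{EW}^*$ from $w_-^1$ to $w_+^0$, and one in $\mathbf{WE}^*$ from $w_+^1$ to $w_-^0$. (iv) The polar segments are disjoint simple directed paths from $w_-^0$ to $w_-^1$ and from $w_+^0$ to $w_+^1$, respectively, possibly of length zero. Together with any two bridges as in (iii) they form a simple directed cycle $w_-^0w_-^1w_+^0w_+^1w_-^0$. (v)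 $\mathbf{WE}^*\cap\partial\mathbf N^*$ and $\mathbf{EW}^*\cap\partial\mathbf N^*$ each consist of a single edge. These two edges are distinct, and they precede and follow, respectively, the directed segment $w_-^0w_-^1$ on $\partial\mathbf N^*$. Likewise $\mathbf{EW}^*\cap\partial\mathbf S^*$ and $\mathbf{WE}^*\cap\partial\mathbf S^*$ each consist of a single edge; these are distinct, and precede and follow, respectively, the directed segment $w_+^0w_+^1$ on $\partial\mathbf S^*$. (vi) $|w_-^0w_-^1|\le|\partial\mathbf N^*|-2$ and $|w_+^0w_+^1|\le|\partial\mathbf S^*|-2$. -/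

import Mathlib

/-- A combinatorial map (rotation system): the standard combinatorial description of a finite cell
decomposition of a closed oriented surface. Elements of `D` are darts, i.e. edges together with one
of their two directions. `α` reverses a dart; `σ` sends a dart to the next dart with the same tail,
in counter-clockwise order, the surface being viewed from outside. -/
structure CMap (D : Type*) where
  σ : Equiv.Perm D
  α : Equiv.Perm D
  α_invol : ∀ d, α (α d) = d
  α_ne : ∀ d, α d ≠ d

namespace CMap

variable {D : Type*} (M : CMap D)

/-- The face permutation: the next dart along the boundary of the face to the left. -/
def φ : Equiv.Perm D := M.σ⁻¹ * M.α

/-- Vertices are the cycles of `σ`. -/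
abbrev Vertex : Type _ := Quotient (Equiv.Perm.SameCycle.setoid M.σ)

/-- Edges are the cycles `{d, α d}` of `α`. -/
abbrev Edge : Type _ := Quotient (Equiv.Perm.SameCycle.setoid M.α)

/-- Faces are the cycles of `φ`. -/
abbrev Face : Type _ := Quotient (Equiv.Perm.SameCycle.setoid M.φ)

/-- The vertex at which a dart starts. -/
def tail (d : D) : M.Vertex := Quotient.mk _ d

/-- The vertex at which a dart ends. -/
def head (d : D) : M.Vertex := M.tail (M.α d)

/-- The edge underlying a dart. -/
def edge (d : D) : M.Edge := Quotient.mk _ d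

/-- The face to the left of a dart. -/
def left (d : D) : M.Face := Quotient.mk _ d

/-- The face to the right of a dart. -/
def right (d : D) : M.Face := M.left (M.α d)

/-- The open cells of the complex. -/
inductive Cell : Type _
  | vert (v : M.Vertex) : Cell
  | edge (e : M.Edge) : Cell
  | face (f : M.Face) : Cell

/-- The map describes the 2-sphere: nonempty, connected, Euler characteristic `2`. -/
structure IsSphere : Prop where
  nonempty : Nonempty D
  connected : ∀ x y : D, ∃ g ∈ Subgroup.closure {M.σ, M.α}, g x = y
  euler : Nat.card M.Vertex + Nat.card M.Face = Nat.card M.Edge + 2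

/-- Regularity of the cell complex: closed edges are embedded arcs, and the boundary of every face
is an embedded circle (it meets no vertex and no edge twice). -/
structure IsRegular : Prop where
  tail_ne_head : ∀ d, M.tail d ≠ M.head d
  left_ne_right : ∀ d, M.left d ≠ M.right d
  face_simple : ∀ d d', M.left d = M.left d' → M.tail d = M.tail d' → d = d'

/-- `x.Lt y`: the cell `x` is contained in the boundary of the cell `y`. -/
inductive Cell.Lt : M.Cell → M.Cell → Prop
  | vert_edge (d : D) : Cell.Lt (.vert (M.tail d)) (.edge (M.edge d))
  | edge_face (d : D) : Cell.Lt (.edge (M.edge d)) (.face (M.left d))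
  | vert_face (d : D) : Cell.Lt (.vert (M.tail d)) (.face (M.left d))

/-- The boundary circle of a face, as a set of cells. -/
def faceBoundary (f : M.Face) : Set M.Cell := {c | Cell.Lt M c (.face f)}

/-- The connected component containing the cell `c` of the complement of the closed set `A`
(`A` is a union of cells): cells outside `A` are joined whenever one is in the closure of the
other. -/
def component (A : Set M.Cell) (c : M.Cell) : Set M.Cell :=
  {c' | Relation.ReflTransGen
    (fun x y => x ∉ A ∧ y ∉ A ∧ (Cell.Lt M x y ∨ Cell.Lt M y x)) c c'}

/-- The 1-skeleton as an undirected simple graph. It is used for distances only, so that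
parallel edges do not matter. -/
def skeleton : SimpleGraph M.Vertex :=
  SimpleGraph.fromRel fun u v => ∃ d, M.tail d = u ∧ M.head d = v

/-- An orientation of all edges: exactly one of the two directions of each edge is selected. -/
def IsOrientation (P : Set D) : Prop := ∀ d, d ∈ P ↔ M.α d ∉ P

/-- `M.IsDiPath P u v p`: the list `p` of darts is a directed walk from `u` to `v`, using only
darts selected by `P`. -/
def IsDiPath (P : Set D) : M.Vertex → M.Vertex → List D → Prop
  | u, v, [] => u = v
  | u, v, d :: p => d ∈ P ∧ M.tail d = u ∧ IsDiPath P (M.head d) v p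

/-- A directed cycle without repeated vertices. -/
def IsDiCycle (P : Set D) (p : List D) : Prop :=
  p ≠ [] ∧ (∃ u, M.IsDiPath P u u p) ∧ (p.map M.tail).Nodup

/-- All vertices and edges of a walk `p` which starts at `u`. -/
def pathCells (u : M.Vertex) (p : List D) : Set M.Cell :=
  {c | c = .vert u ∨ ∃ d ∈ p, c = .edge (M.edge d) ∨ c = .vert (M.head d)}

/-- The directed graph with vertex set `X` and directed edges `P` is bipolar from `n` to `s`:
there are no directed cycles, `n` is the only source, `s` is the only sink. -/
structure IsBipolar (P : Set D) (X : Set M.Vertex) (n s : M.Vertex) : Prop where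
  acyclic : ∀ u p, M.IsDiPath P u u p → p = []
  north_mem : n ∈ X
  south_mem : s ∈ X
  source_iff : ∀ v ∈ X, (∀ d ∈ P, M.head d ≠ v) ↔ v = n
  sink_iff : ∀ v ∈ X, (∀ d ∈ P, M.tail d ≠ v) ↔ v = s

/-- The dual complex. The dart `d`, regarded in the dual, is the dual edge which crosses `d` from
left to right; hence it starts in the face to the left of `d` and ends in the face to the right.
The same set of darts which orients `M` thus orients the dual. -/
def dual : CMap D where
  σ := M.φ
  α := M.α
  α_invol := M.α_invol
  α_ne := M.α_ne

theorem dual_φ_eq : M.dual.φ = M.α * M.σ * M.α⁻¹ := by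
  ext d
  have h : M.α⁻¹ = M.α := by
    ext x
    rw [Equiv.Perm.inv_eq_iff_eq, M.α_invol]
  change (M.φ⁻¹ * M.α) d = _
  simp only [φ, mul_inv_rev, inv_inv, h, Equiv.Perm.mul_apply]

/-- The face `v*` of the dual with barycenter `v`. The dual of a dart with head `v` has `v` to its
left. -/
def dualFace : M.Vertex → M.dual.Face :=
  Quotient.map M.α fun a b h => by
    change Equiv.Perm.SameCycle M.dual.φ (M.α a) (M.α b)
    rw [dual_φ_eq]
    exact Equiv.Perm.SameCycle.conj h

/-- Duality of cells: vertices become faces, edges become edges, faces become vertices. -/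
def dualCell : M.Cell → M.dual.Cell
  | .vert v => .face (M.dualFace v)
  | .edge e => .edge e
  | .face f => .vert f

end CMap

/-- The boundary 2-sphere of a regular complex which is the closure of a single 3-cell, with a
bipolar orientation of the 1-skeleton and two disjoint meridian paths. (A single 3-cell attached
along a regular 2-sphere complex carries no further data.) Each meridian is the list of its edges,
directed from `N` to `S`. -/
structure MeridianSphere (D : Type*) extends CMap D where
  sphere : toCMap.IsSphere
  regular : toCMap.IsRegular
  /-- the darts which point in the direction of their edge -/
  pos : Set D
  orientation : toCMap.IsOrientation pos
  N : toCMap.Vertex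
  S : toCMap.Vertex
  bipolar : toCMap.IsBipolar pos Set.univ N S
  WE : List D
  EW : List D
  WE_ne : WE ≠ []
  EW_ne : EW ≠ []
  WE_path : toCMap.IsDiPath pos N S WE
  EW_path : toCMap.IsDiPath pos N S EW
  disjoint : toCMap.pathCells N WE ∩ toCMap.pathCells N EW ⊆ {.vert N, .vert S}

namespace MeridianSphere

variable {D : Type*} (T : MeridianSphere D)

/-- All cells on the two meridians, including the poles. -/
def meridians : Set T.Cell := T.pathCells T.N T.WE ∪ T.pathCells T.N T.EW

/-- The Western hemisphere: the component of the complement of the meridians which lies to the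
right of the meridian `WE` directed from North to South (viewed from outside). -/
def W : Set T.Cell := T.component T.meridians (.face (T.right (T.WE.head T.WE_ne)))

/-- The Eastern hemisphere: the component of the complement of the meridians which lies to the
left of the meridian `WE`. -/
def E : Set T.Cell := T.component T.meridians (.face (T.left (T.WE.head T.WE_ne)))

/-- The face in `W` adjacent to the first edge of `WE`. -/
def NE : T.Face := T.right (T.WE.head T.WE_ne)

/-- The face in `E` adjacent to the last edge of `WE`. -/
def SW : T.Face := T.left (T.WE.getLast T.WE_ne)

/-- The face in `W` adjacent to the first edge of `EW`; `W` is to the left of `EW`. -/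
def NW : T.Face := T.left (T.EW.head T.EW_ne)

/-- The face in `E` adjacent to the last edge of `EW`; `E` is to the right of `EW`. -/
def SE : T.Face := T.right (T.EW.getLast T.EW_ne)

end MeridianSphere

/-- A 3-cell template, given by its boundary sphere. -/
structure ThreeCellTemplate (D : Type*) extends MeridianSphere D where
  /-- In `W`, edges point towards the meridians at nonpolar meridian vertices. -/
  west_edges : ∀ d, .edge (toCMap.edge d) ∈ toMeridianSphere.W →
    .vert (toCMap.head d) ∈ toMeridianSphere.meridians →
    toCMap.head d ≠ N → toCMap.head d ≠ S → d ∈ pos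
  /-- In `E`, edges point away from the meridians at nonpolar meridian vertices. -/
  east_edges : ∀ d, .edge (toCMap.edge d) ∈ toMeridianSphere.E →
    .vert (toCMap.tail d) ∈ toMeridianSphere.meridians →
    toCMap.tail d ≠ N → toCMap.tail d ≠ S → d ∈ pos
  /-- The boundaries of `NE` and `SW` share an edge of `WE`. -/
  overlap_WE : ∃ d ∈ WE, .edge (toCMap.edge d) ∈
    toCMap.faceBoundary toMeridianSphere.NE ∩ toCMap.faceBoundary toMeridianSphere.SW
  /-- The boundaries of `NW` and `SE` share an edge of `EW`. -/
  overlap_EW : ∃ d ∈ EW, .edge (toCMap.edge d) ∈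
    toCMap.faceBoundary toMeridianSphere.NW ∩ toCMap.faceBoundary toMeridianSphere.SE

namespace ThreeCellTemplate

variable {D : Type*} (T : ThreeCellTemplate D)

/-- The dual vertex `w₋⁰`, the barycenter of the face `NE`. -/
def wm0 : T.dual.Vertex := T.NE

/-- The dual vertex `w₋¹`, the barycenter of the face `NW`. -/
def wm1 : T.dual.Vertex := T.NW

/-- The dual vertex `w₊⁰`, the barycenter of the face `SE`. -/
def wp0 : T.dual.Vertex := T.SE

/-- The dual vertex `w₊¹`, the barycenter of the face `SW`. -/
def wp1 : T.dual.Vertex := T.SW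

/-- The Western core `W*`: the duals of all cells in the open hemisphere `W`. -/
def coreW : Set T.dual.Cell := T.dualCell '' T.W

/-- The Eastern core `E*`. -/
def coreE : Set T.dual.Cell := T.dualCell '' T.E

/-- The meridian dual `WE*`: the duals of all edges and nonpolar vertices of `WE`. -/
def dualWE : Set T.dual.Cell :=
  T.dualCell '' (T.pathCells T.N T.WE \ {.vert T.N, .vert T.S})

/-- The meridian dual `EW*`. -/
def dualEW : Set T.dual.Cell :=
  T.dualCell '' (T.pathCells T.N T.EW \ {.vert T.N, .vert T.S})

/-- The polar circle `∂N*`, as a set of dual edges and vertices. -/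
def circleN : Set T.dual.Cell := T.dual.faceBoundary (T.dualFace T.N)

/-- The polar circle `∂S*`. -/
def circleS : Set T.dual.Cell := T.dual.faceBoundary (T.dualFace T.S)

/-- The number of edges in a set of dual cells. -/
noncomputable def edgeLength (A : Set T.dual.Cell) : ℕ :=
  {e : T.dual.Edge | .edge e ∈ A}.ncard

/-- The edge distance, in the dual 1-skeleton, between two sets of dual cells. -/
noncomputable def edgeDist (A B : Set T.dual.Cell) : ℕ∞ :=
  ⨅ (u : T.dual.Vertex) (_ : .vert u ∈ A) (v : T.dual.Vertex) (_ : .vert v ∈ B),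
    T.dual.skeleton.edist u v

/-- A dual core is bipolar with North pole `n` and South pole `s`, with respect to the dual
orientation of its 1-skeleton. -/
def IsCoreBipolar (A : Set T.dual.Cell) (n s : T.dual.Vertex) : Prop :=
  T.dual.IsBipolar {d | d ∈ T.pos ∧ .edge (T.dual.edge d) ∈ A} {w | .vert w ∈ A} n s

/-- A single directed dual edge from `u` to `v` which belongs to the meridian dual `A`. -/
def IsBridge (A : Set T.dual.Cell) (u v : T.dual.Vertex) (b : D) : Prop :=
  b ∈ T.pos ∧ .edge (T.dual.edge b) ∈ A ∧ T.dual.tail b = u ∧ T.dual.head b = v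

/-- `p` is a directed dual path from `u` to `v`, without repeated vertices, which consists exactly
of the edges and vertices in `A`. -/
def IsSegment (A : Set T.dual.Cell) (u v : T.dual.Vertex) (p : List D) : Prop :=
  T.dual.IsDiPath T.pos u v p ∧ (u :: p.map T.dual.head).Nodup ∧ T.dual.pathCells u p = A

end ThreeCellTemplate


/-!
On a combinatorial sphere the alternating functions on darts are the orthogonal sum of the gradients
of vertex functions and the dual gradients of face functions, by Euler's formula. Two consequences
take the place of planar topology. The signed flow of the closed walk along `WE` and back along `EW`
is the dual gradient of a face function which jumps precisely across the meridians; hence `W` and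
`E` are different components. The flow of a closed directed dual walk is the gradient of a vertex
function which is monotone along directed edges; if the walk does not cross `WE`, this function
agrees at `N` and `S`, hence is constant, and the walk is empty. So the cores are acyclic.

Since the 1-skeleton is acyclic, two edges of every face leave a common vertex, with the face on
opposite sides. If the face is a source or sink of `W*`, this vertex is on the meridians, and unless
it is `N` the edge conditions put both edges on the meridians: one on `WE` and the other on `EW`,
which do not meet there. Hence the face is `NE` or `NW`.

Around `N` the duals of the outgoing edges form a directed circle. The first edges of `WE` and `EW`
cut it into the segment of `W*` and a part in `E*`. Reversing the orientation exchanges the poles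
and the hemispheres, which gives the claims about `E*` and `S`.
-/

theorem isChain_toList_append_self {α : Type*} [Fintype α] [DecidableEq α] (τ : Equiv.Perm α)
    (a : α) : (τ.toList a ++ [a]).IsChain fun x y => τ x = y := by
  rw [List.isChain_iff_getElem]
  intro i hi
  rw [List.length_append, List.length_singleton] at hi
  rw [List.getElem_append_left (by omega), Equiv.Perm.getElem_toList, ← Equiv.Perm.mul_apply,
    ← pow_succ']
  rcases lt_or_ge (i + 1) (τ.toList a).length with hlt | hge
  · rw [List.getElem_append_left hlt, Equiv.Perm.getElem_toList]
  · have hlen : i + 1 = (τ.cycleOf a).support.card := by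
      rw [← Equiv.Perm.length_toList]
      omega
    rw [List.getElem_append_right hge, List.getElem_singleton, hlen,
      ← Equiv.Perm.pow_mod_card_support_cycleOf_self_apply, Nat.mod_self, pow_zero,
      Equiv.Perm.one_apply]

theorem exists_cycle_split {α : Type*} [Finite α] {τ : Equiv.Perm α} {a c : α}
    (h : τ.SameCycle a c) (hne : a ≠ c) :
    ∃ p q : List α, (a :: p ++ c :: q).Nodup ∧ (∀ d, d ∈ a :: p ++ c :: q ↔ τ.SameCycle a d) ∧
      (a :: p ++ [c]).IsChain (fun x y => τ x = y) ∧
      (c :: q ++ [a]).IsChain (fun x y => τ x = y) := by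
  classical
  have := Fintype.ofFinite α
  have ha : a ∈ τ.support := Equiv.Perm.mem_support.2 fun ha => hne (h.eq_of_left ha)
  have hmem : ∀ d, d ∈ τ.toList a ↔ τ.SameCycle a d := fun d => by
    rw [Equiv.Perm.mem_toList_iff, and_iff_left ha]
  have hlen : 0 < (τ.toList a).length := List.length_pos_of_mem ((hmem a).2 (.refl _ _))
  obtain ⟨r, q, hr⟩ := List.append_of_mem ((hmem c).2 h)
  obtain ⟨p, rfl⟩ : ∃ p, r = a :: p := by
    have hget : (τ.toList a)[0] = a := by rw [Equiv.Perm.getElem_toList, pow_zero]; rfl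
    cases r with
    | nil => exact absurd (by simpa [hr] using hget.symm) hne
    | cons b p => exact ⟨p, by simpa [hr] using hget⟩
  have hchain := isChain_toList_append_self τ a
  rw [hr, List.append_assoc, List.cons_append (a := c), List.isChain_split] at hchain
  exact ⟨p, q, hr ▸ Equiv.Perm.nodup_toList τ a, fun d => hr ▸ hmem d, hchain⟩

theorem apply_eq_of_sameCycle {α β : Type*} [Finite α] {τ : Equiv.Perm α} {F : α → β} {a c : α}
    (hF : ∀ d, τ.SameCycle a d → F (τ d) = F d) (h : τ.SameCycle a c) : F c = F a := by
  obtain ⟨n, rfl⟩ := h.exists_nat_pow_eq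
  clear h
  induction n with
  | zero => rfl
  | succ n ih =>
    rw [pow_succ', Equiv.Perm.mul_apply, hF _ ⟨n, by rw [zpow_natCast]⟩, ih]

namespace CMap

variable {D : Type*} (M : CMap D)

section Basic

theorem tail_eq_tail_iff {d d' : D} : M.tail d = M.tail d' ↔ M.σ.SameCycle d d' :=
  Quotient.eq (r := Equiv.Perm.SameCycle.setoid M.σ)

theorem left_eq_left_iff {d d' : D} : M.left d = M.left d' ↔ M.φ.SameCycle d d' :=
  Quotient.eq (r := Equiv.Perm.SameCycle.setoid M.φ)

theorem edge_eq_edge_iff {d d' : D} : M.edge d = M.edge d' ↔ d' = d ∨ d' = M.α d := by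
  have h : M.edge d = M.edge d' ↔ M.α.SameCycle d d' :=
    Quotient.eq (r := Equiv.Perm.SameCycle.setoid M.α)
  have hsq : M.α ^ (2 : ℤ) = 1 := by
    ext x
    simp [zpow_ofNat, pow_two, M.α_invol]
  rw [h]
  constructor
  · rintro ⟨i, rfl⟩
    rcases Int.even_or_odd' i with ⟨k, rfl | rfl⟩
    · left; rw [zpow_mul, hsq, one_zpow, Equiv.Perm.one_apply]
    · right; rw [zpow_add, zpow_mul, hsq, one_zpow, one_mul, zpow_one]
  · rintro (rfl | rfl)
    · exact .refl _ _
    · exact ⟨1, by simp⟩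

@[simp]
theorem edge_α (d : D) : M.edge (M.α d) = M.edge d :=
  (M.edge_eq_edge_iff.2 (Or.inr rfl)).symm

@[simp]
theorem tail_α (d : D) : M.tail (M.α d) = M.head d := rfl

@[simp]
theorem head_α (d : D) : M.head (M.α d) = M.tail d := by
  rw [head, M.α_invol]

@[simp]
theorem left_α (d : D) : M.left (M.α d) = M.right d := rfl

@[simp]
theorem right_α (d : D) : M.right (M.α d) = M.left d := by
  rw [right, M.α_invol]

theorem tail_σ (d : D) : M.tail (M.σ d) = M.tail d :=
  M.tail_eq_tail_iff.2 (Equiv.Perm.sameCycle_apply_left.2 (.refl _ _))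

theorem left_φ (d : D) : M.left (M.φ d) = M.left d :=
  M.left_eq_left_iff.2 (Equiv.Perm.sameCycle_apply_left.2 (.refl _ _))

theorem tail_φ (d : D) : M.tail (M.φ d) = M.head d := by
  rw [head, ← M.tail_σ (M.φ d)]
  simp [φ]

theorem right_eq_left_σ_inv (d : D) : M.right d = M.left (M.σ⁻¹ d) := by
  rw [right, ← M.left_φ]
  simp [φ, M.α_invol]

theorem right_σ (d : D) : M.right (M.σ d) = M.left d := by
  rw [right_eq_left_σ_inv]
  simp

theorem dual_left (d : D) : M.dual.left d = M.dualFace (M.head d) := by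
  change _ = M.dual.left (M.α (M.α d))
  rw [M.α_invol]

theorem dualFace_injective : Function.Injective M.dualFace := by
  intro u v
  induction u using Quotient.inductionOn with | _ a
  induction v using Quotient.inductionOn with | _ b
  intro h
  have h' : M.dual.left (M.α a) = M.dual.left (M.α b) := h
  rw [left_eq_left_iff, dual_φ_eq, Equiv.Perm.sameCycle_conj] at h'
  exact M.tail_eq_tail_iff.2 (by simpa using h')

theorem dualFace_surjective : Function.Surjective M.dualFace := by
  intro f
  induction f using Quotient.inductionOn with | _ a
  exact ⟨M.head a, (M.dual_left a).symm⟩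

theorem dual_isSphere (h : M.IsSphere) : M.dual.IsSphere where
  nonempty := h.nonempty
  connected x y := by
    obtain ⟨g, hg, hxy⟩ := h.connected x y
    refine ⟨g, ?_, hxy⟩
    refine (Subgroup.closure_le _).2 ?_ hg
    have hα : M.α ∈ Subgroup.closure {M.φ, M.α} := Subgroup.subset_closure (by simp)
    have hφ : M.φ ∈ Subgroup.closure {M.φ, M.α} := Subgroup.subset_closure (by simp)
    rintro _ (rfl | rfl)
    · have : M.σ = M.α * M.φ⁻¹ := by simp [φ]
      change M.σ ∈ Subgroup.closure {M.φ, M.α}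
      rw [this]
      exact mul_mem hα (inv_mem hφ)
    · exact hα
  euler := by
    have hcard : Nat.card M.dual.Face = Nat.card M.Vertex :=
      (Nat.card_congr (Equiv.ofBijective _ ⟨M.dualFace_injective, M.dualFace_surjective⟩)).symm
    have heuler := h.euler
    change Nat.card M.Face + Nat.card M.dual.Face = Nat.card M.Edge + 2
    omega

theorem IsSphere.eq_of_tail_eq_head {M : CMap D} (h : M.IsSphere) {R : Type*} (u : M.Vertex → R)
    (hu : ∀ d, u (M.tail d) = u (M.head d)) (v w : M.Vertex) : u v = u w := by
  have key : ∀ g ∈ Subgroup.closure {M.σ, M.α}, ∀ x, u (M.tail (g x)) = u (M.tail x) := by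
    intro g hg
    induction hg using Subgroup.closure_induction with
    | mem g hg =>
      intro x
      rcases hg with rfl | rfl
      · rw [tail_σ]
      · rw [hu x, tail_α]
    | one => simp
    | mul g g' _ _ h h' => intro x; rw [Equiv.Perm.mul_apply, h, h']
    | inv g _ h => intro x; rw [← h]; simp
  induction v using Quotient.inductionOn with | _ a
  induction w using Quotient.inductionOn with | _ b
  obtain ⟨g, hg, hab⟩ := h.connected a b
  have := key g hg a
  rw [hab] at this
  exact this.symm

end Basic

section Potential

/-- The coboundary of a function on vertices. -/
def coboundary : (M.Vertex → ℚ) →ₗ[ℚ] (D → ℚ) where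
  toFun h d := h (M.head d) - h (M.tail d)
  map_add' h h' := by ext d; simp only [Pi.add_apply]; ring
  map_smul' r h := by
    ext d; simp only [Pi.smul_apply, smul_eq_mul, RingHom.id_apply]; ring

/-- The functions on darts which change sign when a dart is reversed. -/
def alternating : Submodule ℚ (D → ℚ) where
  carrier := {c | ∀ d, c (M.α d) = -c d}
  add_mem' h h' d := by simp only [Pi.add_apply, h d, h' d]; ring
  zero_mem' d := by simp
  smul_mem' r c h d := by simp [h d]

theorem range_coboundary_le : LinearMap.range M.coboundary ≤ M.alternating := by
  rintro _ ⟨h, rfl⟩ d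
  simp [coboundary]

theorem finrank_alternating_le [Finite D] : Module.finrank ℚ M.alternating ≤ Nat.card M.Edge := by
  classical
  have := Fintype.ofFinite M.Edge
  let f : M.alternating →ₗ[ℚ] (M.Edge → ℚ) :=
    { toFun := fun c e => c.1 e.out
      map_add' := fun c c' => rfl
      map_smul' := fun r c => rfl }
  have hf : Function.Injective f := by
    rw [← LinearMap.ker_eq_bot, LinearMap.ker_eq_bot']
    rintro ⟨c, hc⟩ hzero
    ext d
    have hout : c (M.edge d).out = 0 := congrFun hzero (M.edge d)
    have hmk : M.edge (M.edge d).out = M.edge d := Quotient.out_eq _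
    rcases M.edge_eq_edge_iff.1 hmk with h | h
    · change c d = 0
      rw [h, hout]
    · change c d = 0
      rw [h, hc, hout, neg_zero]
  have := LinearMap.finrank_le_finrank_of_injective hf
  rwa [Module.finrank_pi, ← Nat.card_eq_fintype_card] at this

theorem card_vertex_le_finrank [Finite D] (hM : M.IsSphere) :
    Nat.card M.Vertex ≤ Module.finrank ℚ (LinearMap.range M.coboundary) + 1 := by
  classical
  have := Fintype.ofFinite M.Vertex
  have hrank := LinearMap.finrank_range_add_finrank_ker M.coboundary
  rw [Module.finrank_pi, ← Nat.card_eq_fintype_card] at hrank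
  have hker : Module.finrank ℚ (LinearMap.ker M.coboundary) ≤ 1 := by
    refine (Submodule.finrank_mono (t := ℚ ∙ (fun _ => 1 : M.Vertex → ℚ)) ?_).trans
      ((finrank_span_le_card _).trans (by simp))
    intro h hh
    obtain ⟨d⟩ := hM.nonempty
    rw [Submodule.mem_span_singleton]
    refine ⟨h (M.tail d), ?_⟩
    ext v
    have : ∀ d, h (M.head d) - h (M.tail d) = 0 := fun d => congrFun hh d
    simp [hM.eq_of_tail_eq_head h (fun d => by linarith [this d]) v (M.tail d)]
  omega

theorem coboundary_dotProduct [Fintype D] (h : M.Vertex → ℚ) (u : M.Face → ℚ) :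
    M.coboundary h ⬝ᵥ M.dual.coboundary u = 0 := by
  have alt : ∀ d, M.coboundary h (M.α d) = - M.coboundary h d :=
    M.range_coboundary_le ⟨h, rfl⟩
  have hleft : ∑ d, M.coboundary h d * u (M.left d) = 0 := by
    simp only [coboundary, LinearMap.coe_mk, AddHom.coe_mk, sub_mul, Finset.sum_sub_distrib]
    rw [sub_eq_zero, ← Equiv.sum_comp M.φ (fun d => h (M.tail d) * u (M.left d))]
    simp only [tail_φ, left_φ]
  have hright : ∑ d, M.coboundary h d * u (M.right d) = 0 := by
    rw [← Equiv.sum_comp M.α]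
    simp only [alt, right_α, neg_mul, Finset.sum_neg_distrib, hleft, neg_zero]
  calc _ = ∑ d, (M.coboundary h d * u (M.right d) - M.coboundary h d * u (M.left d)) :=
        Finset.sum_congr rfl fun d _ => mul_sub _ _ _
    _ = 0 := by rw [Finset.sum_sub_distrib, hleft, hright, sub_zero]

theorem disjoint_range_coboundary_dual [Finite D] :
    Disjoint (LinearMap.range M.coboundary) (LinearMap.range M.dual.coboundary) := by
  have := Fintype.ofFinite D
  rw [Submodule.disjoint_def]
  rintro _ ⟨h, rfl⟩ ⟨u, hu⟩
  have horth := M.coboundary_dotProduct h u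
  rw [hu] at horth
  exact dotProduct_self_eq_zero.1 horth

theorem IsSphere.range_coboundary_sup_dual [Finite D] {M : CMap D} (hM : M.IsSphere) :
    LinearMap.range M.coboundary ⊔ LinearMap.range M.dual.coboundary = M.alternating := by
  refine Submodule.eq_of_le_of_finrank_le
    (sup_le M.range_coboundary_le M.dual.range_coboundary_le) ?_
  have hdim := Submodule.finrank_sup_add_finrank_inf_eq (LinearMap.range M.coboundary)
    (LinearMap.range M.dual.coboundary)
  rw [M.disjoint_range_coboundary_dual.eq_bot, finrank_bot] at hdim
  have hV := M.card_vertex_le_finrank hM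
  have hF : Nat.card M.Face ≤ _ := M.dual.card_vertex_le_finrank (M.dual_isSphere hM)
  have hE := M.finrank_alternating_le
  have hEuler := hM.euler
  omega

theorem IsSphere.exists_potential {M : CMap D} [Fintype D] (hM : M.IsSphere) {c : D → ℚ}
    (hc : ∀ d, c (M.α d) = -c d) (hf : ∀ u : M.Face → ℚ, ∑ d, u (M.left d) * c d = 0) :
    ∃ h : M.Vertex → ℚ, ∀ d, c d = h (M.head d) - h (M.tail d) := by
  obtain ⟨_, ⟨h, rfl⟩, _, ⟨u, rfl⟩, hsum⟩ :=
    Submodule.mem_sup.1 (hM.range_coboundary_sup_dual ▸ (show c ∈ M.alternating from hc))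
  have hr : ∑ d, u (M.right d) * c d = 0 := by
    rw [← Equiv.sum_comp M.α]
    simp only [right_α, hc, mul_neg, Finset.sum_neg_distrib, hf u, neg_zero]
  have horth : M.dual.coboundary u ⬝ᵥ c = 0 := by
    calc _ = ∑ d, (u (M.right d) * c d - u (M.left d) * c d) :=
          Finset.sum_congr rfl fun d _ => sub_mul _ _ _
      _ = 0 := by rw [Finset.sum_sub_distrib, hr, zero_sub, neg_eq_zero]; exact hf u
  rw [← hsum, dotProduct_add, dotProduct_comm, M.coboundary_dotProduct h u, zero_add] at horth
  rw [dotProduct_self_eq_zero.1 horth, add_zero] at hsum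
  exact ⟨h, fun d => (congrFun hsum d).symm⟩

end Potential

section Paths

/-- There is an edge directed from `u` to `v`; used for reachability arguments. -/
def Step (P : Set D) (u v : M.Vertex) : Prop := ∃ d ∈ P, M.tail d = u ∧ M.head d = v

/-- The directed graph with edges `P` has no directed cycles. A cycle is a nonempty closed walk,
as in `IsBipolar`. -/
def IsAcyclic (P : Set D) : Prop := ∀ u p, M.IsDiPath P u u p → p = []

variable {M} {P : Set D} {X : Set M.Vertex} {u v w n s : M.Vertex} {p q : List D} {d d' : D}

theorem Step.of_mem (h : d ∈ P) : M.Step P (M.tail d) (M.head d) := ⟨d, h, rfl, rfl⟩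

theorem α_mem_preimage_α : M.α d ∈ M.α ⁻¹' P ↔ d ∈ P := by
  rw [Set.mem_preimage, M.α_invol]

theorem isDiPath_append :
    M.IsDiPath P u v (p ++ q) ↔ ∃ w, M.IsDiPath P u w p ∧ M.IsDiPath P w v q := by
  induction p generalizing u with
  | nil => simp [IsDiPath]
  | cons d p ih => simp [IsDiPath, ih, and_assoc]

theorem isDiPath_of_isChain (h : (d :: p ++ [d']).IsChain fun x y => M.head x = M.tail y)
    (hp : ∀ x ∈ p, x ∈ P) : M.IsDiPath P (M.head d) (M.tail d') p := by
  induction p generalizing d with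
  | nil => exact (List.isChain_pair (R := fun x y => M.head x = M.tail y)).1 h
  | cons x p ih =>
    obtain ⟨hd, h⟩ := List.isChain_cons_cons.1 h
    exact ⟨hp x List.mem_cons_self, hd.symm, ih h fun y hy => hp y (List.mem_cons_of_mem _ hy)⟩

namespace IsDiPath

theorem mem (h : M.IsDiPath P u v p) (hd : d ∈ p) : d ∈ P := by
  obtain ⟨l, l', rfl⟩ := List.append_of_mem hd
  obtain ⟨w, -, hd, -⟩ := isDiPath_append.1 h
  exact hd

theorem isChain (h : M.IsDiPath P u v p) : p.IsChain fun x y => M.head x = M.tail y := by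
  induction p generalizing u with
  | nil => exact .nil
  | cons x p ih =>
    cases p with
    | nil => exact .singleton _
    | cons y p => exact .cons_cons h.2.2.2.1.symm (ih h.2.2)

theorem apply_eq {β : Type*} {f : M.Vertex → β} (h : M.IsDiPath P u v p)
    (hf : ∀ d ∈ p, f (M.tail d) = f (M.head d)) : f u = f v := by
  induction p generalizing u with
  | nil => exact congrArg f h
  | cons x p ih =>
    rw [← h.2.1, hf x List.mem_cons_self]
    exact ih h.2.2 fun y hy => hf y (List.mem_cons_of_mem _ hy)

theorem tail_head (h : M.IsDiPath P u v p) (hp : p ≠ []) : M.tail (p.head hp) = u := by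
  cases p with
  | nil => exact absurd rfl hp
  | cons x p => exact h.2.1

theorem map_tail_append (h : M.IsDiPath P u v p) : p.map M.tail ++ [v] = u :: p.map M.head := by
  induction p generalizing u with
  | nil => exact congrArg (fun x => [x]) (Eq.symm h)
  | cons x p ih =>
    rw [List.map_cons, List.map_cons, List.cons_append, ih h.2.2, h.2.1]

theorem cons_map_head_reverse (h : M.IsDiPath P u v p) :
    v :: (p.map M.α).reverse.map M.head = (u :: p.map M.head).reverse := by
  rw [← h.map_tail_append]
  simp [Function.comp_def]

theorem reverse (h : M.IsDiPath P u v p) :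
    M.IsDiPath (M.α ⁻¹' P) v u (p.map M.α).reverse := by
  induction p generalizing u with
  | nil => exact Eq.symm h
  | cons x p ih =>
    rw [List.map_cons, List.reverse_cons, isDiPath_append]
    exact ⟨_, ih h.2.2, α_mem_preimage_α.2 h.1, rfl, (M.head_α x).trans h.2.1⟩

end IsDiPath

theorem pathCells_vert_head (hd : d ∈ p) : .vert (M.head d) ∈ M.pathCells u p :=
  Or.inr ⟨d, hd, Or.inr rfl⟩

theorem vert_mem_pathCells : .vert v ∈ M.pathCells u p ↔ v ∈ u :: p.map M.head := by
  constructor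
  · rintro (h | ⟨d, hd, h | h⟩)
    · exact Cell.vert.inj h ▸ List.mem_cons_self
    · cases h
    · exact Cell.vert.inj h ▸ List.mem_cons_of_mem _ (List.mem_map_of_mem hd)
  · intro h
    rcases List.mem_cons.1 h with rfl | h
    · exact Or.inl rfl
    · obtain ⟨d, hd, rfl⟩ := List.mem_map.1 h
      exact pathCells_vert_head hd

theorem edge_mem_pathCells : .edge (M.edge d) ∈ M.pathCells u p ↔ d ∈ p ∨ M.α d ∈ p := by
  constructor
  · rintro (h | ⟨x, hx, h | h⟩)
    · cases h
    · rcases M.edge_eq_edge_iff.1 (Cell.edge.inj h) with rfl | rfl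
      · exact Or.inl hx
      · exact Or.inr hx
    · cases h
  · rintro (h | h)
    · exact Or.inr ⟨d, h, Or.inl rfl⟩
    · exact Or.inr ⟨M.α d, h, Or.inl (by rw [edge_α])⟩

theorem face_notMem_pathCells {f : M.Face} : .face f ∉ M.pathCells u p := by
  rintro (h | ⟨d, -, h | h⟩) <;> cases h

theorem IsDiPath.pathCells_vert_tail (h : M.IsDiPath P u v p) (hd : d ∈ p) :
    .vert (M.tail d) ∈ M.pathCells u p := by
  rw [vert_mem_pathCells, ← h.map_tail_append]
  exact List.mem_append_left _ (List.mem_map_of_mem hd)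

theorem IsDiPath.pathCells_vert_last (h : M.IsDiPath P u v p) : .vert v ∈ M.pathCells u p := by
  rw [vert_mem_pathCells, ← h.map_tail_append]
  exact List.mem_append_right _ List.mem_cons_self

theorem IsDiPath.pathCells_reverse (h : M.IsDiPath P u v p) :
    M.pathCells v (p.map M.α).reverse = M.pathCells u p := by
  ext c
  cases c with
  | vert w =>
    rw [vert_mem_pathCells, vert_mem_pathCells, h.cons_map_head_reverse, List.mem_reverse]
  | edge e =>
    induction e using Quotient.inductionOn with | _ d
    change Cell.edge (M.edge d) ∈ M.pathCells _ _ ↔ Cell.edge (M.edge d) ∈ M.pathCells _ _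
    rw [edge_mem_pathCells, edge_mem_pathCells, List.mem_reverse, List.mem_reverse,
      List.mem_map_of_injective M.α.injective, or_comm, List.mem_map]
    exact or_congr_right ⟨fun ⟨x, hx, hxd⟩ => by rwa [← hxd, M.α_invol],
      fun hd => ⟨M.α d, hd, M.α_invol d⟩⟩
  | face f => exact iff_of_false face_notMem_pathCells face_notMem_pathCells

theorem exists_isDiPath_of_transGen (h : Relation.TransGen (M.Step P) u v) :
    ∃ p, p ≠ [] ∧ M.IsDiPath P u v p := by
  induction h using Relation.TransGen.head_induction_on with
  | single h =>
    obtain ⟨d, hd, rfl, rfl⟩ := h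
    exact ⟨[d], by simp, hd, rfl, rfl⟩
  | head h _ ih =>
    obtain ⟨d, hd, rfl, rfl⟩ := h
    obtain ⟨p, -, hp⟩ := ih
    exact ⟨d :: p, by simp, hd, rfl, hp⟩

namespace IsAcyclic

theorem not_transGen_self (hP : M.IsAcyclic P) (u : M.Vertex) :
    ¬ Relation.TransGen (M.Step P) u u := fun h => by
  obtain ⟨p, hp, h⟩ := exists_isDiPath_of_transGen h
  exact hp (hP u p h)

theorem of_reverse (hP : M.IsAcyclic (M.α ⁻¹' P)) : M.IsAcyclic P := fun u p h => by
  simpa using hP u _ h.reverse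

theorem reverse (hP : M.IsAcyclic P) : M.IsAcyclic (M.α ⁻¹' P) :=
  of_reverse <| by
    rwa [← Set.preimage_comp, show M.α ∘ M.α = id from funext M.α_invol, Set.preimage_id]

theorem nodup_map_tail (hP : M.IsAcyclic P) (h : M.IsDiPath P u v p) : (p.map M.tail).Nodup := by
  have hstep : (p.map M.tail).IsChain (Relation.TransGen (M.Step P)) := by
    rw [List.isChain_map]
    refine (List.IsChain.iff_mem.1 h.isChain).imp ?_
    rintro x y ⟨hx, -, hxy⟩
    exact .single ⟨x, h.mem hx, rfl, hxy⟩
  refine (List.isChain_iff_pairwise.1 hstep).imp ?_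
  rintro x _ hx rfl
  exact hP.not_transGen_self x hx

theorem nodup_map_head (hP : M.IsAcyclic P) (h : M.IsDiPath P u v p) : (p.map M.head).Nodup := by
  have hrev := hP.reverse.nodup_map_tail h.reverse
  rw [List.map_reverse, List.nodup_reverse, List.map_map] at hrev
  exact hrev

theorem wellFounded_step [Finite D] (hP : M.IsAcyclic P) : WellFounded (M.Step P) := by
  have : Std.Irrefl (Relation.TransGen (M.Step P)) := ⟨hP.not_transGen_self⟩
  exact Subrelation.wf (fun h => Relation.TransGen.single h)
    (Finite.wellFounded_of_trans_of_irrefl (Relation.TransGen (M.Step P)))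

theorem exists_local_source [Finite D] (hP : M.IsAcyclic P) (ho : M.IsOrientation P) (f : M.Face) :
    ∃ d, M.left d = f ∧ d ∉ P ∧ M.φ d ∈ P := by
  obtain ⟨d, hd⟩ : ∃ d, M.left d = f := Quotient.exists_rep f
  obtain ⟨_, ⟨x, hx, rfl⟩, hmin⟩ :=
    hP.wellFounded_step.has_min {v | ∃ x, M.left x = f ∧ M.tail x = v} ⟨_, d, hd, rfl⟩
  have hy : M.φ (M.φ⁻¹ x) = x := M.φ.apply_symm_apply x
  refine ⟨M.φ⁻¹ x, by rw [← M.left_φ, hy, hx], fun hyP => ?_, ?_⟩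
  · refine hmin _ ⟨M.φ⁻¹ x, by rw [← M.left_φ, hy, hx], rfl⟩ ⟨_, hyP, rfl, ?_⟩
    rw [← tail_φ, hy]
  · rw [hy, ho]
    intro hxP
    exact hmin _ ⟨M.φ x, by rw [left_φ, hx], rfl⟩ ⟨_, hxP, (M.tail_φ x).symm, M.head_α x⟩

theorem reflTransGen_of_unique_source [Finite D] (hP : M.IsAcyclic P)
    (hX : ∀ d ∈ P, M.tail d ∈ X) (source : ∀ v ∈ X, (∀ d ∈ P, M.head d ≠ v) → v = n)
    (hv : v ∈ X) : Relation.ReflTransGen (M.Step P) n v := by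
  induction v using hP.wellFounded_step.induction with | _ v ih
  by_cases h : ∀ d ∈ P, M.head d ≠ v
  · rw [source v hv h]
  · push Not at h
    obtain ⟨x, hx, rfl⟩ := h
    exact (ih _ (.of_mem hx) (hX x hx)).tail (.of_mem hx)

theorem head_ne_of_unique_source [Finite D] (hP : M.IsAcyclic P)
    (hX : ∀ d ∈ P, M.tail d ∈ X) (source : ∀ v ∈ X, (∀ d ∈ P, M.head d ≠ v) → v = n)
    (hd : d ∈ P) : M.head d ≠ n := by
  rintro rfl
  exact hP.not_transGen_self _
    (.tail' (hP.reflTransGen_of_unique_source hX source (hX d hd)) (.of_mem hd))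

end IsAcyclic

namespace IsBipolar

theorem reverse (h : M.IsBipolar P X n s) : M.IsBipolar (M.α ⁻¹' P) X s n where
  acyclic := IsAcyclic.reverse h.acyclic
  north_mem := h.south_mem
  south_mem := h.north_mem
  source_iff v hv := by
    rw [← h.sink_iff v hv]
    exact ⟨fun H d hd => M.head_α d ▸ H (M.α d) (α_mem_preimage_α.2 hd),
      fun H d hd => H _ hd⟩
  sink_iff v hv := by
    rw [← h.source_iff v hv]
    exact ⟨fun H d hd => H (M.α d) (α_mem_preimage_α.2 hd),
      fun H d hd => M.head_α d ▸ H _ hd⟩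

theorem of_unique [Finite D] (hP : M.IsAcyclic P) (hn : n ∈ X) (hs : s ∈ X)
    (tail_mem : ∀ d ∈ P, M.tail d ∈ X) (head_mem : ∀ d ∈ P, M.head d ∈ X)
    (source : ∀ v ∈ X, (∀ d ∈ P, M.head d ≠ v) → v = n)
    (sink : ∀ v ∈ X, (∀ d ∈ P, M.tail d ≠ v) → v = s) : M.IsBipolar P X n s where
  acyclic := hP
  north_mem := hn
  south_mem := hs
  source_iff v hv := by
    refine ⟨source v hv, ?_⟩
    rintro rfl d hd
    exact hP.head_ne_of_unique_source tail_mem source hd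
  sink_iff v hv := by
    refine ⟨sink v hv, ?_⟩
    rintro rfl d hd
    rw [← head_α]
    exact hP.reverse.head_ne_of_unique_source (X := X) (fun x hx => M.head_α x ▸ head_mem _ hx)
      (fun w hw H => sink w hw fun x hx =>
        M.head_α x ▸ H (M.α x) (α_mem_preimage_α.2 hx))
      (α_mem_preimage_α.2 hd)

theorem north_le [Finite D] {β : Type*} [Preorder β] (hb : M.IsBipolar P Set.univ n s)
    {h : M.Vertex → β} (hh : ∀ d ∈ P, h (M.tail d) ≤ h (M.head d)) (v : M.Vertex) :
    h n ≤ h v := by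
  have hreach : Relation.ReflTransGen (M.Step P) n v :=
    IsAcyclic.reflTransGen_of_unique_source hb.acyclic (fun _ _ => Set.mem_univ _)
      (fun w hw => (hb.source_iff w hw).1) (Set.mem_univ v)
  induction hreach with
  | refl => exact le_rfl
  | tail _ hstep ih =>
    obtain ⟨d, hd, rfl, rfl⟩ := hstep
    exact ih.trans (hh d hd)

theorem le_south [Finite D] {β : Type*} [Preorder β] (hb : M.IsBipolar P Set.univ n s)
    {h : M.Vertex → β} (hh : ∀ d ∈ P, h (M.tail d) ≤ h (M.head d)) (v : M.Vertex) :
    h v ≤ h s :=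
  hb.reverse.north_le (β := βᵒᵈ) (h := OrderDual.toDual ∘ h)
    (fun d hd => M.head_α d ▸ hh (M.α d) hd) v

end IsBipolar

end Paths

section Flow

open Classical in
/-- The number of times the walk `p` traverses `d`, minus the number of times it traverses the
reverse of `d`. -/
noncomputable def flow (p : List D) (d : D) : ℚ := p.count d - p.count (M.α d)

theorem flow_α (p : List D) (d : D) : M.flow p (M.α d) = - M.flow p d := by
  rw [flow, flow, M.α_invol, neg_sub]

variable {M} {P : Set D} {u v : M.Vertex} {p : List D}

theorem sum_mul_flow [Fintype D] (h : M.IsDiPath P u v p) (f : M.Vertex → ℚ) :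
    ∑ d, f (M.tail d) * M.flow p d = f u - f v := by
  classical
  induction p generalizing u with
  | nil =>
    obtain rfl : u = v := h
    simp [flow]
  | cons x p ih =>
    obtain ⟨-, rfl, h⟩ := h
    have hterm : ∀ d, f (M.tail d) * M.flow (x :: p) d =
        (if x = d then f (M.tail d) else 0) - (if M.α x = d then f (M.tail d) else 0) +
          f (M.tail d) * M.flow p d := by
      intro d
      have hswap : x = M.α d ↔ M.α x = d :=
        ⟨fun h => by rw [h, M.α_invol], fun h => by rw [← h, M.α_invol]⟩
      simp only [flow, List.count_cons, beq_iff_eq, hswap]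
      split_ifs <;> push_cast <;> ring
    simp only [hterm, Finset.sum_add_distrib, Finset.sum_sub_distrib, ih h, Finset.sum_ite_eq,
      Finset.mem_univ, if_true, tail_α]
    ring

theorem IsOrientation.flow_nonneg (hP : M.IsOrientation P) (hp : ∀ d ∈ p, d ∈ P) {d : D}
    (hd : d ∈ P) : 0 ≤ M.flow p d := by
  classical
  have : M.α d ∉ p := fun h => (hP d).1 hd (hp _ h)
  simp [flow, List.count_eq_zero.2 this]

theorem IsOrientation.flow_pos (hP : M.IsOrientation P) (hp : ∀ d ∈ p, d ∈ P) {d : D}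
    (hd : d ∈ p) : 0 < M.flow p d := by
  classical
  have : M.α d ∉ p := fun h => (hP d).1 (hp _ hd) (hp _ h)
  simpa [flow, List.count_eq_zero.2 this] using hd

theorem flow_eq_zero {d : D} (hd : d ∉ p) (hd' : M.α d ∉ p) : M.flow p d = 0 := by
  classical
  simp [flow, List.count_eq_zero.2 hd, List.count_eq_zero.2 hd']

theorem IsSphere.exists_dual_potential [Fintype D] (hM : M.IsSphere) {c : D → ℚ}
    (hc : ∀ d, c (M.α d) = -c d) (hf : ∀ u : M.Vertex → ℚ, ∑ d, u (M.tail d) * c d = 0) :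
    ∃ g : M.Face → ℚ, ∀ d, c d = g (M.right d) - g (M.left d) := by
  refine (M.dual_isSphere hM).exists_potential hc fun u => ?_
  simp only [dual_left]
  rw [← Equiv.sum_comp M.α]
  simp only [head_α, hc, mul_neg, Finset.sum_neg_distrib, neg_eq_zero]
  exact hf fun v => u (M.dualFace v)

end Flow

section Component

variable {M} {A : Set M.Cell} {c : M.Cell} {d d' x y : D}

/-- The dart `d` bounds, or lies at, the cell `x`. Two cells of which one is in the boundary of the
other are incident to a common dart. -/
def Incident (d : D) (x : M.Cell) : Prop :=
  x = .vert (M.tail d) ∨ x = .edge (M.edge d) ∨ x = .face (M.left d)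

theorem Cell.Lt.exists_incident {x y : M.Cell} (h : Cell.Lt M x y) :
    ∃ d, M.Incident d x ∧ M.Incident d y := by
  cases h with
  | vert_edge d => exact ⟨d, by simp [Incident]⟩
  | edge_face d => exact ⟨d, by simp [Incident]⟩
  | vert_face d => exact ⟨d, by simp [Incident]⟩

theorem component_subset_compl (hc : c ∉ A) : M.component A c ⊆ Aᶜ := by
  rintro x hx
  induction hx with
  | refl => exact hc
  | tail _ h _ => exact h.2.1

theorem mem_component_iff_of_lt {x y : M.Cell} (hx : x ∉ A) (hy : y ∉ A) (h : Cell.Lt M x y) :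
    x ∈ M.component A c ↔ y ∈ M.component A c :=
  ⟨fun hc => hc.tail ⟨hx, hy, Or.inl h⟩, fun hc => hc.tail ⟨hy, hx, Or.inr h⟩⟩

theorem mem_component_comm {x y : M.Cell} (h : x ∈ M.component A y) : y ∈ M.component A x := by
  induction h with
  | refl => exact .refl
  | tail _ h ih => exact ih.head ⟨h.2.1, h.1, h.2.2.symm⟩

theorem component_eq_of_mem {x y : M.Cell} (h : x ∈ M.component A y) :
    M.component A x = M.component A y :=
  Set.ext fun _ => ⟨fun hx => h.trans hx, fun hy => (mem_component_comm h).trans hy⟩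

theorem edge_mem_component_iff_left (hA : ∀ f, .face f ∉ A) (hd : .edge (M.edge d) ∉ A) :
    .edge (M.edge d) ∈ M.component A c ↔ .face (M.left d) ∈ M.component A c :=
  mem_component_iff_of_lt hd (hA _) (.edge_face d)

theorem edge_mem_component_iff_right (hA : ∀ f, .face f ∉ A) (hd : .edge (M.edge d) ∉ A) :
    .edge (M.edge d) ∈ M.component A c ↔ .face (M.right d) ∈ M.component A c := by
  rw [← M.edge_α] at hd ⊢
  exact edge_mem_component_iff_left hA hd

theorem left_mem_component_iff_right_of_isChain (hA : ∀ f, .face f ∉ A) {p : List D}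
    (h : (x :: p ++ [y]).IsChain fun a b => M.σ a = b) (hp : ∀ z ∈ p, .edge (M.edge z) ∉ A) :
    .face (M.left x) ∈ M.component A c ↔ .face (M.right y) ∈ M.component A c := by
  induction p generalizing x with
  | nil =>
    obtain rfl := (List.isChain_pair (R := fun a b => M.σ a = b)).1 h
    rw [right_σ]
  | cons z p ih =>
    obtain ⟨rfl, h⟩ := List.isChain_cons_cons.1 h
    have hz := hp _ List.mem_cons_self
    rw [← ih h fun w hw => hp w (List.mem_cons_of_mem _ hw), ← edge_mem_component_iff_left hA hz,
      edge_mem_component_iff_right hA hz, right_σ]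

theorem left_mem_component_iff_right [Finite D] (hA : ∀ f, .face f ∉ A)
    (hxy : M.tail x = M.tail y) (hne : x ≠ y)
    (h : ∀ z, M.tail z = M.tail x → .edge (M.edge z) ∈ A → z = x ∨ z = y) :
    .face (M.left x) ∈ M.component A c ↔ .face (M.right y) ∈ M.component A c := by
  obtain ⟨p, q, hnodup, hmem, hchain, -⟩ := exists_cycle_split (M.tail_eq_tail_iff.1 hxy) hne
  refine left_mem_component_iff_right_of_isChain hA hchain fun z hz hzA => ?_
  have htail : M.tail z = M.tail x :=
    (M.tail_eq_tail_iff.2 ((hmem z).1 (List.mem_append_left _ (List.mem_cons_of_mem _ hz)))).symm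
  rcases h z htail hzA with rfl | rfl
  · exact (List.nodup_cons.1 hnodup).1 (List.mem_append_left _ hz)
  · exact (List.nodup_append.1 hnodup).2.2 z (List.mem_cons_of_mem _ hz) z List.mem_cons_self rfl

theorem apply_left_eq_of_incident [Finite D] {β : Type*} {g : M.Face → β}
    (hA : ∀ d, Cell.edge (M.edge d) ∈ A → Cell.vert (M.tail d) ∈ A)
    (hg : ∀ d, Cell.edge (M.edge d) ∉ A → g (M.right d) = g (M.left d)) (hc : c ∉ A)
    (hd : M.Incident d c) (hd' : M.Incident d' c) : g (M.left d') = g (M.left d) := by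
  rcases hd with rfl | rfl | rfl <;> rcases hd' with h | h | h <;>
    simp only [Cell.vert.injEq, Cell.edge.injEq, Cell.face.injEq, reduceCtorEq] at h
  · refine apply_eq_of_sameCycle (F := fun z => g (M.left z)) (fun z hz => ?_)
      (M.tail_eq_tail_iff.1 h)
    have htail : M.tail (M.σ z) = M.tail d := by rw [tail_σ, M.tail_eq_tail_iff.2 hz]
    have hright := hg (M.σ z) fun hz => hc (htail ▸ hA _ hz)
    rw [right_σ] at hright
    exact hright.symm
  · rcases M.edge_eq_edge_iff.1 h with rfl | rfl
    · rfl
    · exact hg d hc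
  · rw [h]

theorem apply_eq_of_mem_component [Finite D] {β : Type*} {g : M.Face → β}
    (hA : ∀ d, Cell.edge (M.edge d) ∈ A → Cell.vert (M.tail d) ∈ A)
    (hg : ∀ d, Cell.edge (M.edge d) ∉ A → g (M.right d) = g (M.left d))
    {f f' : M.Face} (h : .face f' ∈ M.component A (.face f)) : g f' = g f := by
  suffices key : ∀ x ∈ M.component A (.face f), ∀ d, M.Incident d x → g (M.left d) = g f by
    induction f' using Quotient.inductionOn with | _ d
    exact key _ h d (Or.inr (Or.inr rfl))
  intro x hx
  induction hx with
  | refl =>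
    rintro d (h | h | h) <;> cases h
    rfl
  | @tail y z _ hyz ih =>
    obtain ⟨d, hdy, hdz⟩ : ∃ d, M.Incident d y ∧ M.Incident d z := by
      rcases hyz.2.2 with h | h
      · exact h.exists_incident
      · exact h.exists_incident.imp fun _ => And.symm
    intro d' hd'
    rw [apply_left_eq_of_incident hA hg hyz.2.1 hdz hd', ih d hdy]

theorem component_eq_singleton (hA : ∀ d, Cell.edge (M.edge d) ∈ A → Cell.vert (M.tail d) ∈ A)
    {f : M.Face} (hf : .face f ∈ M.component A c)
    (h : ∀ d, M.left d = f → .edge (M.edge d) ∈ A) : M.component A c = {.face f} := by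
  rw [← component_eq_of_mem hf]
  refine Set.Subset.antisymm (fun x hx => ?_) (Set.singleton_subset_iff.2 .refl)
  induction hx with
  | refl => rfl
  | @tail _ y _ hy ih =>
    obtain rfl := ih
    obtain ⟨-, hy, hlt | hlt⟩ := hy
    · cases hlt
    · generalize hx : Cell.face f = x at hlt
      cases hlt with
      | vert_edge d => cases hx
      | edge_face d => exact absurd (h d (Cell.face.inj hx).symm) hy
      | vert_face d => exact absurd (hA d (h d (Cell.face.inj hx).symm)) hy

theorem left_or_right_of_edge_mem_faceBoundary {f : M.Face}
    (h : .edge (M.edge d) ∈ M.faceBoundary f) : M.left d = f ∨ M.right d = f := by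
  change Cell.Lt M (.edge (M.edge d)) (.face f) at h
  generalize hx : Cell.edge (M.edge d) = x at h
  generalize hy : Cell.face f = y at h
  cases h with
  | vert_edge d' => cases hx
  | edge_face d' =>
    rw [Cell.face.inj hy]
    rcases M.edge_eq_edge_iff.1 (Cell.edge.inj hx) with rfl | rfl
    · exact Or.inl rfl
    · exact Or.inr rfl
  | vert_face d' => cases hx

end Component

section PathPair

variable {M} {P Q : Set D} {n s : M.Vertex} {p q : List D} {A : Set M.Cell} {c : M.Cell}
  {d d' z : D}

theorem IsBipolar.head_ne (hb : M.IsBipolar P Set.univ n s) (hd : d ∈ P) : M.head d ≠ n :=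
  (hb.source_iff n trivial).2 rfl d hd

theorem IsBipolar.tail_ne (hb : M.IsBipolar P Set.univ n s) (hd : d ∈ P) : M.tail d ≠ s :=
  (hb.sink_iff s trivial).2 rfl d hd

theorem eq_or_eq_of_consecutive (hb : M.IsBipolar P Set.univ n s) (hp : M.IsDiPath P n s p)
    (hq : M.IsDiPath P n s q) (hdisj : M.pathCells n p ∩ M.pathCells n q ⊆ {.vert n, .vert s})
    (hd : d ∈ p) (hd' : d' ∈ p) (h : M.head d = M.tail d') (hz : M.tail z = M.head d)
    (hzA : .edge (M.edge z) ∈ M.pathCells n p ∪ M.pathCells n q) : z = M.α d ∨ z = d' := by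
  have hv : .vert (M.head d) ∉ M.pathCells n q := fun hv => by
    rcases hdisj ⟨pathCells_vert_head hd, hv⟩ with hv | hv
    · exact hb.head_ne (hp.mem hd) (Cell.vert.inj hv)
    · exact hb.tail_ne (hp.mem hd') (h ▸ Cell.vert.inj hv)
  rcases hzA with hzA | hzA <;> rcases edge_mem_pathCells.1 hzA with hz' | hz'
  · exact Or.inr (List.inj_on_of_nodup_map (IsAcyclic.nodup_map_tail hb.acyclic hp) hz' hd'
      (hz.trans h))
  · left
    rw [List.inj_on_of_nodup_map (IsAcyclic.nodup_map_head hb.acyclic hp) hd hz'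
      (by rw [head_α, hz]), M.α_invol]
  · exact absurd (hz ▸ hq.pathCells_vert_tail hz') hv
  · refine absurd ?_ hv
    rw [← hz, ← M.head_α]
    exact pathCells_vert_head hz'

theorem sides_mem_component_iff_of_consecutive [Finite D] (hP : M.IsOrientation P)
    (hb : M.IsBipolar P Set.univ n s) (hp : M.IsDiPath P n s p) (hq : M.IsDiPath P n s q)
    (hdisj : M.pathCells n p ∩ M.pathCells n q ⊆ {.vert n, .vert s})
    (hA : A = M.pathCells n p ∪ M.pathCells n q) (hd : d ∈ p) (hd' : d' ∈ p)
    (h : M.head d = M.tail d') :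
    (.face (M.left d) ∈ M.component A c ↔ .face (M.left d') ∈ M.component A c) ∧
    (.face (M.right d) ∈ M.component A c ↔ .face (M.right d') ∈ M.component A c) := by
  have hface : ∀ f, .face f ∉ A := fun f hf =>
    (hA ▸ hf).elim face_notMem_pathCells face_notMem_pathCells
  have hne : M.α d ≠ d' := fun h => (hP d).1 (hp.mem hd) (h ▸ hp.mem hd')
  have hedge : ∀ z, M.tail z = M.head d → .edge (M.edge z) ∈ A → z = M.α d ∨ z = d' :=
    fun z hz hzA => eq_or_eq_of_consecutive hb hp hq hdisj hd hd' h hz (hA ▸ hzA)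
  constructor
  · rw [left_mem_component_iff_right hface (x := d') (y := M.α d) h.symm hne.symm, right_α]
    exact fun z hz hzA => (hedge z (hz.trans h.symm) hzA).symm
  · rw [← left_mem_component_iff_right hface (x := M.α d) (y := d') h hne hedge, left_α]

theorem sides_mem_component_iff [Finite D] (hP : M.IsOrientation P)
    (hb : M.IsBipolar P Set.univ n s) (hp : M.IsDiPath P n s p) (hq : M.IsDiPath P n s q)
    (hdisj : M.pathCells n p ∩ M.pathCells n q ⊆ {.vert n, .vert s})
    (hA : A = M.pathCells n p ∪ M.pathCells n q) (hd : d ∈ p) (hne : p ≠ []) :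
    (.face (M.left (p.head hne)) ∈ M.component A c ↔ .face (M.left d) ∈ M.component A c) ∧
    (.face (M.right (p.head hne)) ∈ M.component A c ↔ .face (M.right d) ∈ M.component A c) := by
  let R : D → D → Prop := fun x y =>
    (.face (M.left x) ∈ M.component A c ↔ .face (M.left y) ∈ M.component A c) ∧
    (.face (M.right x) ∈ M.component A c ↔ .face (M.right y) ∈ M.component A c)
  have : IsTrans D R := ⟨fun _ _ _ h h' => ⟨h.1.trans h'.1, h.2.trans h'.2⟩⟩
  have hchain : p.IsChain R := (List.IsChain.iff_mem.1 hp.isChain).imp fun x y ⟨hx, hy, hxy⟩ =>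
    sides_mem_component_iff_of_consecutive hP hb hp hq hdisj hA hx hy hxy
  cases p with
  | nil => exact absurd rfl hne
  | cons x p =>
    rcases List.mem_cons.1 hd with rfl | hd
    · exact ⟨Iff.rfl, Iff.rfl⟩
    · exact (List.pairwise_cons.1 (List.isChain_iff_pairwise.1 hchain)).1 d hd

-- A closed dual walk is a nonnegative flow, so its potential is monotone; it is constant on `p`.
theorem IsBipolar.dual_acyclic [Finite D] (hM : M.IsSphere) (hP : M.IsOrientation P)
    (hb : M.IsBipolar P Set.univ n s) (hp : M.IsDiPath P n s p) (hQP : Q ⊆ P)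
    (hQp : ∀ d ∈ p, d ∉ Q) : M.dual.IsAcyclic Q := by
  intro f r hr
  cases nonempty_fintype D
  have hrP : ∀ d ∈ r, d ∈ P := fun d hd => hQP (hr.mem hd)
  obtain ⟨h, hh⟩ := hM.exists_potential (M.flow_α r) fun u =>
    (sum_mul_flow hr u).trans (sub_self _)
  have hmono : ∀ d ∈ P, h (M.tail d) ≤ h (M.head d) := fun d hd => by
    linarith [hh d, hP.flow_nonneg hrP hd]
  have hns : h n = h s := hp.apply_eq fun d hd => by
    have hdr : d ∉ r := fun hdr => hQp d hd (hr.mem hdr)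
    have hαdr : M.α d ∉ r := fun hdr => (hP d).1 (hp.mem hd) (hrP _ hdr)
    linarith [hh d, flow_eq_zero (M := M) hdr hαdr]
  refine List.eq_nil_iff_forall_not_mem.2 fun d hd => ?_
  linarith [hh d, hP.flow_pos hrP hd, hb.north_le hmono (M.tail d), hb.le_south hmono (M.head d)]

end PathPair

section DualCells

variable {M} {C : Set M.Cell} {v : M.Vertex} {d : D}

theorem dualCell_injective : Function.Injective M.dualCell := by
  rintro (v | e | f) (v' | e' | f') h
  case vert.vert => exact congrArg Cell.vert (M.dualFace_injective (Cell.face.inj h))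
  all_goals first | rfl | (cases h; rfl) | cases h

theorem vert_mem_dualCell_image {f : M.Face} :
    (Cell.vert f : M.dual.Cell) ∈ M.dualCell '' C ↔ .face f ∈ C :=
  dualCell_injective.mem_set_image (a := .face f)

theorem edge_mem_dualCell_image {e : M.Edge} :
    (Cell.edge e : M.dual.Cell) ∈ M.dualCell '' C ↔ .edge e ∈ C :=
  dualCell_injective.mem_set_image (a := .edge e)

theorem edge_mem_dualCell_image_pathCells_diff {u v w : M.Vertex} {p : List D} :
    .edge (M.dual.edge d) ∈ M.dualCell '' (M.pathCells u p \ {.vert v, .vert w}) ↔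
      d ∈ p ∨ M.α d ∈ p := by
  rw [← edge_mem_pathCells (u := u)]
  exact edge_mem_dualCell_image.trans
    ⟨fun h => h.1, fun h => ⟨h, by rintro (h | h) <;> cases h⟩⟩

theorem faceBoundary_dualFace (v : M.Vertex) : M.dual.faceBoundary (M.dualFace v) =
    {x | ∃ d, M.tail d = v ∧ (x = .edge (M.dual.edge d) ∨ x = .vert (M.dual.head d))} := by
  ext x
  constructor
  · intro h
    change Cell.Lt M.dual x (.face (M.dualFace v)) at h
    generalize hy : Cell.face (M.dualFace v) = y at h
    cases h with
    | vert_edge d => cases hy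
    | edge_face d =>
      exact ⟨M.α d, M.dualFace_injective ((M.dual_left d).symm.trans (Cell.face.inj hy).symm),
        Or.inl (congrArg _ (M.dual.edge_α d).symm)⟩
    | vert_face d =>
      exact ⟨M.α d, M.dualFace_injective ((M.dual_left d).symm.trans (Cell.face.inj hy).symm),
        Or.inr (congrArg _ (M.dual.head_α d).symm)⟩
  · have hleft : ∀ d, M.dual.left (M.α d) = M.dualFace (M.tail d) := fun d => by
      rw [dual_left, head_α]
    rintro ⟨d, rfl, rfl | rfl⟩
    · rw [← hleft, ← M.dual.edge_α d]
      exact Cell.Lt.edge_face (M := M.dual) (M.α d)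
    · rw [← hleft]
      exact Cell.Lt.vert_face (M := M.dual) (M.α d)

theorem edge_mem_faceBoundary_dualFace :
    .edge (M.dual.edge d) ∈ M.dual.faceBoundary (M.dualFace v) ↔ M.tail d = v ∨ M.head d = v := by
  rw [faceBoundary_dualFace]
  constructor
  · rintro ⟨x, rfl, h | h⟩
    · rcases M.dual.edge_eq_edge_iff.1 (Cell.edge.inj h) with rfl | rfl
      · exact Or.inl rfl
      · exact Or.inr rfl
    · cases h
  · rintro (rfl | rfl)
    · exact ⟨d, rfl, Or.inl rfl⟩
    · exact ⟨M.α d, rfl, Or.inl (congrArg _ (M.dual.edge_α d).symm)⟩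

theorem IsOrientation.length_le_ncard [Finite D] {P : Set D} (hP : M.IsOrientation P) {l : List D}
    (hl : l.Nodup) (hlP : ∀ d ∈ l, d ∈ P) {B : Set M.Edge} (hB : ∀ d ∈ l, M.edge d ∈ B) :
    l.length ≤ B.ncard := by
  classical
  have hnodup : (l.map M.edge).Nodup := hl.map_on fun x hx y hy h => by
    rcases M.edge_eq_edge_iff.1 h with h | h
    · exact h.symm
    · exact absurd (h ▸ hlP y hy) ((hP x).1 (hlP x hx))
  calc l.length = (l.map M.edge).toFinset.card := by
        rw [List.toFinset_card_of_nodup hnodup, List.length_map]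
    _ = ((l.map M.edge).toFinset : Set M.Edge).ncard := (Set.ncard_coe_finset _).symm
    _ ≤ B.ncard := Set.ncard_le_ncard fun e he => by
        obtain ⟨d, hd, rfl⟩ := List.mem_map.1 (List.mem_toFinset.1 he)
        exact hB d hd

end DualCells

section Arc

variable {M} {P : Set D} {C : Set M.Cell} {τ : Equiv.Perm D} {a c x : D} {p : List D}

theorem mem_iff_of_isChain (hp : (x :: p).IsChain fun y z => M.head y = M.tail z)
    (hC : ∀ d ∈ p, (.edge (M.edge d) ∈ C ↔ .vert (M.tail d) ∈ C) ∧
      (.edge (M.edge d) ∈ C ↔ .vert (M.head d) ∈ C)) :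
    ∀ d ∈ p, (.edge (M.edge d) ∈ C ↔ .vert (M.head x) ∈ C) ∧
      (.vert (M.head d) ∈ C ↔ .vert (M.head x) ∈ C) := by
  induction p generalizing x with
  | nil => exact fun d hd => absurd hd List.not_mem_nil
  | cons y p ih =>
    obtain ⟨hxy, hp⟩ := List.isChain_cons_cons.1 hp
    obtain ⟨htail, hhead⟩ := hC y List.mem_cons_self
    rw [← hxy] at htail
    intro d hd
    rcases List.mem_cons.1 hd with rfl | hd
    · exact ⟨htail, hhead.symm.trans htail⟩
    · obtain ⟨hedge, hvert⟩ := ih hp (fun z hz => hC z (List.mem_cons_of_mem _ hz)) d hd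
      exact ⟨hedge.trans (hhead.symm.trans htail), hvert.trans (hhead.symm.trans htail)⟩

theorem exists_isDiPath_pathCells_eq_inter [Finite D] (hτ : ∀ d, M.head d = M.tail (τ d))
    (hP : ∀ d, τ.SameCycle a d → d ∈ P) (hinj : Set.InjOn M.head {d | τ.SameCycle a d})
    (hac : τ.SameCycle a c) (ha : .vert (M.head a) ∈ C) (hc : .vert (M.head c) ∉ C)
    (haC : .edge (M.edge a) ∉ C) (hcC : .edge (M.edge c) ∉ C)
    (hC : ∀ d, τ.SameCycle a d → d ≠ a → d ≠ c →
      (.edge (M.edge d) ∈ C ↔ .vert (M.tail d) ∈ C) ∧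
      (.edge (M.edge d) ∈ C ↔ .vert (M.head d) ∈ C)) :
    ∃ p, M.IsDiPath P (M.head a) (M.tail c) p ∧ (M.head a :: p.map M.head).Nodup ∧
      M.pathCells (M.head a) p =
        C ∩ {x | ∃ d, τ.SameCycle a d ∧ (x = .edge (M.edge d) ∨ x = .vert (M.head d))} := by
  obtain ⟨p, q, hnodup, hmem, hp, hq⟩ := exists_cycle_split hac fun h => hc (h ▸ ha)
  replace hp := hp.imp fun x y (h : τ x = y) => h ▸ hτ x
  replace hq := hq.imp fun x y (h : τ x = y) => h ▸ hτ x
  have hsub : ∀ d ∈ a :: p, τ.SameCycle a d := fun d hd => (hmem d).1 (List.mem_append_left _ hd)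
  obtain ⟨hnodup₁, hnodup₂, hne⟩ := List.nodup_append.1 hnodup
  have hpC := mem_iff_of_isChain (C := C) hp.left_of_append fun d hd =>
    hC d (hsub d (List.mem_cons_of_mem _ hd)) (fun h => (List.nodup_cons.1 hnodup₁).1 (h ▸ hd))
      (hne d (List.mem_cons_of_mem _ hd) c List.mem_cons_self)
  have hqC := mem_iff_of_isChain (C := C) hq.left_of_append fun d hd =>
    hC d ((hmem d).1 (List.mem_append_right _ (List.mem_cons_of_mem _ hd)))
      (hne a List.mem_cons_self d (List.mem_cons_of_mem _ hd)).symm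
      (fun h => (List.nodup_cons.1 hnodup₂).1 (h ▸ hd))
  refine ⟨p, isDiPath_of_isChain hp fun d hd => hP d (hsub d (List.mem_cons_of_mem _ hd)),
    hnodup₁.map_on (f := M.head) fun x hx y hy h => hinj (hsub x hx) (hsub y hy) h, ?_⟩
  ext x
  constructor
  · rintro (rfl | ⟨d, hd, rfl | rfl⟩)
    · exact ⟨ha, a, .refl _ _, Or.inr rfl⟩
    · exact ⟨(hpC d hd).1.2 ha, d, hsub d (List.mem_cons_of_mem _ hd), Or.inl rfl⟩
    · exact ⟨(hpC d hd).2.2 ha, d, hsub d (List.mem_cons_of_mem _ hd), Or.inr rfl⟩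
  · rintro ⟨hx, d, hd, h⟩
    rcases List.mem_append.1 ((hmem d).2 hd) with hd | hd <;>
      rcases List.mem_cons.1 hd with rfl | hd <;> rcases h with rfl | rfl
    · exact absurd hx haC
    · exact Or.inl rfl
    · exact Or.inr ⟨d, hd, Or.inl rfl⟩
    · exact Or.inr ⟨d, hd, Or.inr rfl⟩
    · exact absurd hx hcC
    · exact absurd hx hc
    · exact absurd ((hqC d hd).1.1 hx) hc
    · exact absurd ((hqC d hd).2.1 hx) hc

end Arc

end CMap

namespace MeridianSphere

variable {D : Type*} (T : MeridianSphere D)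

theorem N_ne_S : T.N ≠ T.S := fun h =>
  T.WE_ne (T.bipolar.acyclic T.N T.WE (by simpa only [← h] using T.WE_path))

theorem α_mem_pos {d : D} (h : d ∉ T.pos) : T.α d ∈ T.pos :=
  (T.orientation _).2 ((T.α_invol d).symm ▸ h)

theorem face_notMem_meridians (f : T.Face) : .face f ∉ T.meridians := fun h =>
  h.elim CMap.face_notMem_pathCells CMap.face_notMem_pathCells

theorem edge_mem_meridians {d : D} : .edge (T.edge d) ∈ T.meridians ↔
    (d ∈ T.WE ∨ T.α d ∈ T.WE) ∨ (d ∈ T.EW ∨ T.α d ∈ T.EW) :=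
  or_congr CMap.edge_mem_pathCells CMap.edge_mem_pathCells

theorem tail_mem_meridians {d : D} (h : .edge (T.edge d) ∈ T.meridians) :
    .vert (T.tail d) ∈ T.meridians := by
  rcases T.edge_mem_meridians.1 h with (h | h) | (h | h)
  · exact Or.inl (T.WE_path.pathCells_vert_tail h)
  · rw [← T.head_α]
    exact Or.inl (CMap.pathCells_vert_head h)
  · exact Or.inr (T.EW_path.pathCells_vert_tail h)
  · rw [← T.head_α]
    exact Or.inr (CMap.pathCells_vert_head h)

theorem edge_ne_of_mem {d d' : D} (hd : d ∈ T.WE) (hd' : d' ∈ T.EW) : T.edge d ≠ T.edge d' := by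
  intro h
  have hWE : .edge (T.edge d) ∈ T.pathCells T.N T.WE := CMap.edge_mem_pathCells.2 (Or.inl hd)
  have hEW : .edge (T.edge d) ∈ T.pathCells T.N T.EW := h ▸ CMap.edge_mem_pathCells.2 (Or.inl hd')
  rcases T.disjoint ⟨hWE, hEW⟩ with h | h <;> cases h

theorem WE_head_ne_EW_head : T.WE.head T.WE_ne ≠ T.EW.head T.EW_ne := fun h =>
  T.edge_ne_of_mem (List.head_mem _) (List.head_mem _) (congrArg T.edge h)

theorem eq_WE_head {d : D} (hd : d ∈ T.WE) (h : T.tail d = T.N) : d = T.WE.head T.WE_ne :=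
  List.inj_on_of_nodup_map (CMap.IsAcyclic.nodup_map_tail T.bipolar.acyclic T.WE_path) hd
    (List.head_mem _) (h.trans (T.WE_path.tail_head T.WE_ne).symm)

theorem eq_EW_head {d : D} (hd : d ∈ T.EW) (h : T.tail d = T.N) : d = T.EW.head T.EW_ne :=
  List.inj_on_of_nodup_map (CMap.IsAcyclic.nodup_map_tail T.bipolar.acyclic T.EW_path) hd
    (List.head_mem _) (h.trans (T.EW_path.tail_head T.EW_ne).symm)

theorem eq_head_of_tail_eq_N {d : D} (h : T.tail d = T.N) (hd : .edge (T.edge d) ∈ T.meridians) :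
    d = T.WE.head T.WE_ne ∨ d = T.EW.head T.EW_ne := by
  rcases T.edge_mem_meridians.1 hd with (hd | hd) | (hd | hd)
  · exact Or.inl (T.eq_WE_head hd h)
  · exact absurd ((T.head_α d).trans h) (T.bipolar.head_ne (T.WE_path.mem hd))
  · exact Or.inr (T.eq_EW_head hd h)
  · exact absurd ((T.head_α d).trans h) (T.bipolar.head_ne (T.EW_path.mem hd))

theorem tail_WE_head_eq_tail_EW_head :
    T.tail (T.WE.head T.WE_ne) = T.tail (T.EW.head T.EW_ne) :=
  (T.WE_path.tail_head T.WE_ne).trans (T.EW_path.tail_head T.EW_ne).symm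

theorem notMem_meridians_of_mem_W {x : T.Cell} (h : x ∈ T.W) : x ∉ T.meridians :=
  CMap.component_subset_compl (T.face_notMem_meridians _) h

theorem edge_mem_W_iff_left {d : D} (h : .edge (T.edge d) ∉ T.meridians) :
    .edge (T.edge d) ∈ T.W ↔ .face (T.left d) ∈ T.W :=
  CMap.edge_mem_component_iff_left T.face_notMem_meridians h

theorem edge_mem_W_iff_right {d : D} (h : .edge (T.edge d) ∉ T.meridians) :
    .edge (T.edge d) ∈ T.W ↔ .face (T.right d) ∈ T.W :=
  CMap.edge_mem_component_iff_right T.face_notMem_meridians h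

section Hemispheres

variable [Finite D]

theorem right_mem_W {d : D} (hd : d ∈ T.WE) : .face (T.right d) ∈ T.W :=
  (CMap.sides_mem_component_iff T.orientation T.bipolar T.WE_path T.EW_path T.disjoint rfl hd
    T.WE_ne).2.1 .refl

theorem left_mem_E {d : D} (hd : d ∈ T.WE) : .face (T.left d) ∈ T.E :=
  (CMap.sides_mem_component_iff T.orientation T.bipolar T.WE_path T.EW_path T.disjoint rfl hd
    T.WE_ne).1.1 .refl

theorem sides_EW_mem_component_iff {c : T.Cell} {d : D} (hd : d ∈ T.EW) :
    (.face (T.left (T.EW.head T.EW_ne)) ∈ T.component T.meridians c ↔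
      .face (T.left d) ∈ T.component T.meridians c) ∧
    (.face (T.right (T.EW.head T.EW_ne)) ∈ T.component T.meridians c ↔
      .face (T.right d) ∈ T.component T.meridians c) :=
  CMap.sides_mem_component_iff T.orientation T.bipolar T.EW_path T.WE_path
    (by rw [Set.inter_comm]; exact T.disjoint) (Set.union_comm _ _) hd T.EW_ne

theorem left_mem_W {d : D} (hd : d ∈ T.EW) : .face (T.left d) ∈ T.W := by
  refine (T.sides_EW_mem_component_iff hd).1.1 ?_
  rw [CMap.left_mem_component_iff_right T.face_notMem_meridians
    T.tail_WE_head_eq_tail_EW_head.symm T.WE_head_ne_EW_head.symm]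
  · exact .refl
  · intro z hz h
    exact (T.eq_head_of_tail_eq_N (hz.trans (T.EW_path.tail_head T.EW_ne)) h).symm

theorem right_mem_E {d : D} (hd : d ∈ T.EW) : .face (T.right d) ∈ T.E := by
  refine (T.sides_EW_mem_component_iff hd).2.1 ?_
  rw [← CMap.left_mem_component_iff_right T.face_notMem_meridians T.tail_WE_head_eq_tail_EW_head
    T.WE_head_ne_EW_head]
  · exact .refl
  · intro z hz h
    exact T.eq_head_of_tail_eq_N (hz.trans (T.WE_path.tail_head T.WE_ne)) h

theorem disjoint_W_E : Disjoint T.W T.E := by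
  rw [Set.disjoint_left]
  intro x hW hE
  cases nonempty_fintype D
  set a := T.WE.head T.WE_ne
  have ha : a ∈ T.WE := List.head_mem _
  obtain ⟨g, hg⟩ := T.sphere.exists_dual_potential
    (c := fun d => T.flow T.WE d - T.flow T.EW d)
    (fun d => by rw [T.flow_α, T.flow_α]; ring) fun u => by
      simp only [mul_sub, Finset.sum_sub_distrib, CMap.sum_mul_flow T.WE_path,
        CMap.sum_mul_flow T.EW_path, sub_self]
  have hconst : ∀ d, .edge (T.edge d) ∉ T.meridians → g (T.right d) = g (T.left d) := by
    intro d hd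
    rw [edge_mem_meridians, not_or, not_or, not_or] at hd
    have hgd := hg d
    rw [CMap.flow_eq_zero hd.1.1 hd.1.2, CMap.flow_eq_zero hd.2.1 hd.2.2] at hgd
    linarith
  have hjump : g (T.left a) < g (T.right a) := by
    have hWE := T.orientation.flow_pos (fun d => T.WE_path.mem) ha
    have hEW : T.flow T.EW a = 0 := CMap.flow_eq_zero
      (fun h => T.edge_ne_of_mem ha h rfl) (fun h => T.edge_ne_of_mem ha h (T.edge_α a).symm)
    linarith [hg a]
  have hsame := CMap.apply_eq_of_mem_component (fun _ => T.tail_mem_meridians) hconst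
    (hW.trans (CMap.mem_component_comm hE))
  exact hjump.ne hsame

theorem NE_mem_W : .face T.NE ∈ T.W := T.right_mem_W (List.head_mem _)

theorem NW_mem_W : .face T.NW ∈ T.W := T.left_mem_W (List.head_mem _)

theorem SE_mem_E : .face T.SE ∈ T.E := T.right_mem_E (List.getLast_mem _)

theorem SW_mem_E : .face T.SW ∈ T.E := T.left_mem_E (List.getLast_mem _)

theorem notMem_E {x : T.Cell} (h : x ∈ T.W) : x ∉ T.E :=
  Set.disjoint_left.1 T.disjoint_W_E h

theorem mem_EW_of_left_mem_W {d : D} (hd : d ∈ T.pos) (hf : .face (T.left d) ∈ T.W)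
    (h : .edge (T.edge d) ∈ T.meridians) : d ∈ T.EW := by
  rcases T.edge_mem_meridians.1 h with (h | h) | (h | h)
  · exact absurd (T.left_mem_E h) (T.notMem_E hf)
  · exact absurd (T.WE_path.mem h) ((T.orientation d).1 hd)
  · exact h
  · exact absurd (T.EW_path.mem h) ((T.orientation d).1 hd)

theorem mem_WE_of_right_mem_W {d : D} (hd : d ∈ T.pos) (hf : .face (T.right d) ∈ T.W)
    (h : .edge (T.edge d) ∈ T.meridians) : d ∈ T.WE := by
  rcases T.edge_mem_meridians.1 h with (h | h) | (h | h)
  · exact h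
  · exact absurd (T.WE_path.mem h) ((T.orientation d).1 hd)
  · exact absurd (T.right_mem_E h) (T.notMem_E hf)
  · exact absurd (T.EW_path.mem h) ((T.orientation d).1 hd)

theorem exists_opposite_out_edges (f : T.Face) : ∃ d ∈ T.pos, ∃ d' ∈ T.pos,
    T.right d = f ∧ T.left d' = f ∧ T.tail d = T.tail d' := by
  obtain ⟨z, rfl, hz, hz'⟩ :=
    CMap.IsAcyclic.exists_local_source T.bipolar.acyclic T.orientation f
  exact ⟨T.α z, T.α_mem_pos hz, T.φ z, hz', T.right_α z, T.left_φ z, (T.tail_φ z).symm⟩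

end Hemispheres

section Reverse

/-- The same sphere and meridians with all edges reversed. This exchanges the poles, hence also the
hemispheres. -/
abbrev reverse : MeridianSphere D where
  toCMap := T.toCMap
  sphere := T.sphere
  regular := T.regular
  pos := T.α ⁻¹' T.pos
  orientation d := T.orientation (T.α d)
  N := T.S
  S := T.N
  bipolar := T.bipolar.reverse
  WE := (T.WE.map T.α).reverse
  EW := (T.EW.map T.α).reverse
  WE_ne := by simpa using T.WE_ne
  EW_ne := by simpa using T.EW_ne
  WE_path := T.WE_path.reverse
  EW_path := T.EW_path.reverse
  disjoint := by
    rw [T.WE_path.pathCells_reverse, T.EW_path.pathCells_reverse, Set.pair_comm]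
    exact T.disjoint

theorem reverse_meridians : T.reverse.meridians = T.meridians :=
  congrArg₂ _ T.WE_path.pathCells_reverse T.EW_path.pathCells_reverse

theorem reverse_WE_head : T.reverse.WE.head T.reverse.WE_ne = T.α (T.WE.getLast T.WE_ne) := by
  simp

theorem reverse_WE_getLast : T.reverse.WE.getLast T.reverse.WE_ne = T.α (T.WE.head T.WE_ne) := by
  simp

theorem reverse_EW_head : T.reverse.EW.head T.reverse.EW_ne = T.α (T.EW.getLast T.EW_ne) := by
  simp

theorem reverse_EW_getLast : T.reverse.EW.getLast T.reverse.EW_ne = T.α (T.EW.head T.EW_ne) := by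
  simp

theorem reverse_NE : T.reverse.NE = T.SW := by
  rw [NE, reverse_WE_head]
  exact T.right_α _

theorem reverse_SW : T.reverse.SW = T.NE := by
  rw [SW, reverse_WE_getLast]
  exact T.left_α _

theorem reverse_NW : T.reverse.NW = T.SE := by
  rw [NW, reverse_EW_head]
  exact T.left_α _

theorem reverse_SE : T.reverse.SE = T.NW := by
  rw [SE, reverse_EW_getLast]
  exact T.right_α _

theorem reverse_W [Finite D] : T.reverse.W = T.E := by
  change T.component T.reverse.meridians (.face T.reverse.NE) = _
  rw [reverse_meridians, reverse_NE]
  exact CMap.component_eq_of_mem (T.left_mem_E (List.getLast_mem _))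

theorem reverse_E [Finite D] : T.reverse.E = T.W := by
  change T.component T.reverse.meridians (.face (T.left _)) = _
  rw [reverse_meridians, reverse_WE_head]
  exact CMap.component_eq_of_mem (T.right_mem_W (List.getLast_mem _))

end Reverse

end MeridianSphere

namespace ThreeCellTemplate

variable {D : Type*} (T : ThreeCellTemplate D)

section Poles

theorem edge_mem_meridians_of_tail_mem {d : D} (hd : d ∈ T.pos)
    (hf : .face (T.left d) ∈ T.W ∨ .face (T.right d) ∈ T.W)
    (hv : .vert (T.tail d) ∈ T.meridians) (hN : T.tail d ≠ T.N) :
    .edge (T.edge d) ∈ T.meridians := by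
  by_contra hm
  refine (T.orientation d).1 hd (T.west_edges _ ?_ ?_ ?_ ?_)
  · rw [T.edge_α]
    exact hf.elim (T.edge_mem_W_iff_left hm).2 (T.edge_mem_W_iff_right hm).2
  · rwa [T.head_α]
  · rwa [T.head_α]
  · rw [T.head_α]
    exact T.bipolar.tail_ne hd

variable [Finite D]

theorem disjoint_cores : Disjoint T.coreW T.coreE :=
  (Set.disjoint_image_iff CMap.dualCell_injective).2 T.disjoint_W_E

theorem tail_eq_N {d d' : D} (hd : d ∈ T.pos) (hd' : d' ∈ T.pos) (ht : T.tail d = T.tail d')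
    (hf : .face (T.right d) ∈ T.W) (hf' : .face (T.left d') ∈ T.W)
    (hv : .vert (T.tail d) ∈ T.meridians) : T.tail d = T.N := by
  by_contra hN
  have hWE : d ∈ T.WE := T.mem_WE_of_right_mem_W hd hf
    (T.edge_mem_meridians_of_tail_mem hd (Or.inr hf) hv hN)
  have hEW : d' ∈ T.EW := T.mem_EW_of_left_mem_W hd' hf'
    (T.edge_mem_meridians_of_tail_mem hd' (Or.inl hf') (ht ▸ hv) (ht ▸ hN))
  rcases T.disjoint ⟨T.WE_path.pathCells_vert_tail hWE,
    ht ▸ T.EW_path.pathCells_vert_tail hEW⟩ with h | h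
  · exact hN (CMap.Cell.vert.inj h)
  · exact T.bipolar.tail_ne hd (CMap.Cell.vert.inj h)

theorem eq_NE_of_source {f : T.Face} (hf : .face f ∈ T.W)
    (h : ∀ d ∈ T.pos, .edge (T.edge d) ∈ T.W → T.right d ≠ f) : f = T.NE := by
  obtain ⟨d, hd, d', hd', rfl, hf', ht⟩ := T.exists_opposite_out_edges f
  have hm : .edge (T.edge d) ∈ T.meridians := by
    by_contra hm
    exact h d hd ((T.edge_mem_W_iff_right hm).2 hf) rfl
  have hN := T.tail_eq_N hd hd' ht hf (hf' ▸ hf) (T.tail_mem_meridians hm)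
  exact congrArg T.right (T.eq_WE_head (T.mem_WE_of_right_mem_W hd hf hm) hN)

theorem eq_NW_of_sink {f : T.Face} (hf : .face f ∈ T.W)
    (h : ∀ d ∈ T.pos, .edge (T.edge d) ∈ T.W → T.left d ≠ f) : f = T.NW := by
  obtain ⟨d, hd, d', hd', hf', rfl, ht⟩ := T.exists_opposite_out_edges f
  have hm : .edge (T.edge d') ∈ T.meridians := by
    by_contra hm
    exact h d' hd' ((T.edge_mem_W_iff_left hm).2 hf) rfl
  have hN := T.tail_eq_N hd hd' ht (hf' ▸ hf) hf (ht ▸ T.tail_mem_meridians hm)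
  exact congrArg T.left (T.eq_EW_head (T.mem_EW_of_left_mem_W hd' hf hm) (ht ▸ hN))

theorem isCoreBipolar_W : T.IsCoreBipolar T.coreW T.wm0 T.wm1 := by
  have hedge : ∀ d, (CMap.Cell.edge (T.dual.edge d) : T.dual.Cell) ∈ T.coreW ↔
      .edge (T.edge d) ∈ T.W := fun d => CMap.edge_mem_dualCell_image
  have hface : ∀ f : T.Face, (CMap.Cell.vert f : T.dual.Cell) ∈ T.coreW ↔ .face f ∈ T.W :=
    fun f => CMap.vert_mem_dualCell_image
  have hmer : ∀ d, .edge (T.edge d) ∈ T.W → .edge (T.edge d) ∉ T.meridians :=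
    fun d => T.notMem_meridians_of_mem_W
  refine CMap.IsBipolar.of_unique ?_ ((hface _).2 T.NE_mem_W) ((hface _).2 T.NW_mem_W)
    (fun d hd => ?_) (fun d hd => ?_) (fun f hf h => ?_) (fun f hf h => ?_)
  · exact T.bipolar.dual_acyclic T.sphere T.orientation T.WE_path (fun d hd => hd.1) fun d hd h =>
      hmer d ((hedge d).1 h.2) (T.edge_mem_meridians.2 (Or.inl (Or.inl hd)))
  · have hW := (hedge d).1 hd.2
    exact (hface _).2 ((T.edge_mem_W_iff_left (hmer d hW)).1 hW)
  · have hW := (hedge d).1 hd.2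
    exact (hface _).2 ((T.edge_mem_W_iff_right (hmer d hW)).1 hW)
  · exact T.eq_NE_of_source ((hface f).1 hf) fun d hd hdW => h d ⟨hd, (hedge d).2 hdW⟩
  · exact T.eq_NW_of_sink ((hface f).1 hf) fun d hd hdW => h d ⟨hd, (hedge d).2 hdW⟩

end Poles

section Reverse

variable [Finite D]

/-- The same template with all edges reversed. This exchanges the roles of the poles and of the
hemispheres. -/
abbrev reverse : ThreeCellTemplate D where
  toMeridianSphere := T.toMeridianSphere.reverse
  west_edges d hd hm hS hN := by
    rw [T.reverse_W, ← T.edge_α] at hd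
    rw [T.reverse_meridians] at hm
    exact T.east_edges (T.α d) hd hm hN hS
  east_edges d hd hm hS hN := by
    rw [T.reverse_E, ← T.edge_α] at hd
    rw [T.reverse_meridians, ← T.head_α] at hm
    rw [← T.head_α] at hN hS
    exact T.west_edges (T.α d) hd hm hN hS
  overlap_WE := by
    obtain ⟨d, hd, hNE, hSW⟩ := T.overlap_WE
    rw [T.reverse_NE, T.reverse_SW]
    refine ⟨T.α d, List.mem_reverse.2 (List.mem_map_of_mem hd), ?_⟩
    rw [T.edge_α]
    exact ⟨hSW, hNE⟩
  overlap_EW := by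
    obtain ⟨d, hd, hNW, hSE⟩ := T.overlap_EW
    rw [T.reverse_NW, T.reverse_SE]
    refine ⟨T.α d, List.mem_reverse.2 (List.mem_map_of_mem hd), ?_⟩
    rw [T.edge_α]
    exact ⟨hSE, hNW⟩

theorem reverse_coreW : T.reverse.coreW = T.coreE :=
  congrArg (T.dualCell '' ·) T.reverse_W

theorem reverse_dualWE : T.reverse.dualWE = T.dualWE := by
  change T.dualCell '' (T.pathCells T.S (T.WE.map T.α).reverse \ {.vert T.S, .vert T.N}) = _
  rw [T.WE_path.pathCells_reverse, Set.pair_comm]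
  rfl

theorem reverse_dualEW : T.reverse.dualEW = T.dualEW := by
  change T.dualCell '' (T.pathCells T.S (T.EW.map T.α).reverse \ {.vert T.S, .vert T.N}) = _
  rw [T.EW_path.pathCells_reverse, Set.pair_comm]
  rfl

theorem isCoreBipolar_E : T.IsCoreBipolar T.coreE T.wp0 T.wp1 := by
  have h := T.reverse.isCoreBipolar_W.reverse
  rw [T.reverse_coreW] at h
  have hset : T.dual.α ⁻¹' {d | d ∈ T.reverse.pos ∧ .edge (T.dual.edge d) ∈ T.coreE} =
      {d | d ∈ T.pos ∧ .edge (T.dual.edge d) ∈ T.coreE} := by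
    ext d
    refine and_congr CMap.α_mem_preimage_α ?_
    rw [T.dual.edge_α]
  have hwp0 : T.reverse.wm1 = T.wp0 := T.reverse_NW
  have hwp1 : T.reverse.wm0 = T.wp1 := T.reverse_NE
  rw [hwp0, hwp1] at h
  rw [IsCoreBipolar, ← hset]
  exact h

end Reverse

section Circles

theorem exists_shared_edge_iff :
    (∃ e, .edge e ∈ T.circleN ∩ T.circleS) ↔ T.skeleton.dist T.N T.S = 1 := by
  rw [SimpleGraph.dist_eq_one_iff_adj, CMap.skeleton, SimpleGraph.fromRel_adj]
  constructor
  · rintro ⟨e, hN, hS⟩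
    induction e using Quotient.inductionOn with | _ d
    refine ⟨T.N_ne_S, ?_⟩
    rcases CMap.edge_mem_faceBoundary_dualFace.1 hN with hN | hN <;>
      rcases CMap.edge_mem_faceBoundary_dualFace.1 hS with hS | hS
    · exact absurd (hN.symm.trans hS) T.N_ne_S
    · exact Or.inl ⟨d, hN, hS⟩
    · exact Or.inr ⟨d, hS, hN⟩
    · exact absurd (hN.symm.trans hS) T.N_ne_S
  · have hshared : ∀ d, T.tail d = T.N → T.head d = T.S →
        ∃ e, .edge e ∈ T.circleN ∩ T.circleS := fun d hN hS =>
      ⟨T.dual.edge d, CMap.edge_mem_faceBoundary_dualFace.2 (Or.inl hN),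
        CMap.edge_mem_faceBoundary_dualFace.2 (Or.inr hS)⟩
    rintro ⟨-, ⟨d, hN, hS⟩ | ⟨d, hS, hN⟩⟩
    · exact hshared d hN hS
    · exact hshared (T.α d) hN ((T.head_α d).trans hS)

theorem poles_eq_iff {c : T.Cell} {u v : T.Face} (hu : .face u ∈ T.component T.meridians c)
    (hb : T.IsCoreBipolar (T.dualCell '' T.component T.meridians c) u v) :
    u = v ↔ T.dualCell '' T.component T.meridians c = {.vert u} ∧
      T.dualCell '' T.component T.meridians c = {.vert v} := by
  refine ⟨?_, fun ⟨hu, hv⟩ => CMap.Cell.vert.inj (Set.singleton_injective (hu.symm.trans hv))⟩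
  rintro rfl
  rw [and_self, CMap.component_eq_singleton (fun d => T.tail_mem_meridians) hu,
    Set.image_singleton]
  · rfl
  rintro d rfl
  by_contra hm
  have hd := (CMap.edge_mem_component_iff_left T.face_notMem_meridians hm).2 hu
  have hv := CMap.vert_mem_dualCell_image.2 hu
  by_cases hp : d ∈ T.pos
  · exact (hb.sink_iff _ hv).2 rfl d ⟨hp, CMap.edge_mem_dualCell_image.2 hd⟩ rfl
  · refine (hb.source_iff _ hv).2 rfl (T.α d)
      ⟨T.α_mem_pos hp, CMap.edge_mem_dualCell_image.2 ?_⟩ (T.right_α d)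
    exact (T.edge_α d).symm ▸ hd

theorem meridianDual_inter_circleN {p : List D} (hp : T.IsDiPath T.pos T.N T.S p) (hne : p ≠ []) :
    T.dualCell '' (T.pathCells T.N p \ {.vert T.N, .vert T.S}) ∩ T.circleN =
      {.edge (T.dual.edge (p.head hne))} := by
  refine Set.Subset.antisymm ?_ (Set.singleton_subset_iff.2
    ⟨CMap.edge_mem_dualCell_image_pathCells_diff.2 (Or.inl (List.head_mem _)),
      CMap.edge_mem_faceBoundary_dualFace.2 (Or.inl (hp.tail_head hne))⟩)
  rw [circleN, CMap.faceBoundary_dualFace]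
  rintro x ⟨hx, d, hd, rfl | rfl⟩
  · rcases CMap.edge_mem_dualCell_image_pathCells_diff.1 hx with h | h
    · rw [List.inj_on_of_nodup_map (CMap.IsAcyclic.nodup_map_tail T.bipolar.acyclic hp) h
        (List.head_mem hne) (hd.trans (hp.tail_head hne).symm)]
      rfl
    · exact absurd ((T.head_α d).trans hd) (T.bipolar.head_ne (hp.mem h))
  · exact absurd (CMap.vert_mem_dualCell_image.1 hx).1 CMap.face_notMem_pathCells

end Circles

section Bridges

variable {A B X Y : Set T.dual.Cell} {u u' v v' : T.dual.Vertex} {p q : List D} {b b' : D}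

theorem exists_isBridge_EW [Finite D] : ∃ b ∈ T.EW, T.IsBridge T.dualEW T.wm1 T.wp0 b := by
  obtain ⟨d, hd, hNW, hSE⟩ := T.overlap_EW
  refine ⟨d, hd, T.EW_path.mem hd,
    CMap.edge_mem_dualCell_image_pathCells_diff.2 (Or.inl hd), ?_, ?_⟩
  · refine (CMap.left_or_right_of_edge_mem_faceBoundary hNW).resolve_right fun h => ?_
    exact T.notMem_E T.NW_mem_W (h ▸ T.right_mem_E hd)
  · refine (CMap.left_or_right_of_edge_mem_faceBoundary hSE).resolve_left fun h => ?_
    exact T.notMem_E (h ▸ T.left_mem_W hd) T.SE_mem_E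

theorem exists_isBridge_WE [Finite D] : ∃ b ∈ T.WE, T.IsBridge T.dualWE T.wp1 T.wm0 b := by
  obtain ⟨d, hd, hNE, hSW⟩ := T.overlap_WE
  refine ⟨d, hd, T.WE_path.mem hd,
    CMap.edge_mem_dualCell_image_pathCells_diff.2 (Or.inl hd), ?_, ?_⟩
  · refine (CMap.left_or_right_of_edge_mem_faceBoundary hSW).resolve_right fun h => ?_
    exact T.notMem_E (h ▸ T.right_mem_W hd) T.SW_mem_E
  · refine (CMap.left_or_right_of_edge_mem_faceBoundary hNE).resolve_left fun h => ?_
    exact T.notMem_E T.NE_mem_W (h ▸ T.left_mem_E hd)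

variable {T}

theorem IsBridge.edgeDist_le_one (hb : T.IsBridge X u v b) (hu : .vert u ∈ A) (hv : .vert v ∈ B) :
    T.edgeDist A B ≤ 1 := by
  obtain ⟨-, -, htail, hhead⟩ := hb
  refine (iInf₂_le u hu).trans ((iInf₂_le v hv).trans ?_)
  rw [SimpleGraph.edist_le_one_iff_adj_or_eq]
  by_cases h : u = v
  · exact Or.inr h
  · exact Or.inl ((SimpleGraph.fromRel_adj _ _ _).2 ⟨h, Or.inl ⟨b, htail, hhead⟩⟩)

theorem IsSegment.start_mem (hp : T.IsSegment A u v p) : .vert u ∈ A :=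
  hp.2.2 ▸ Or.inl rfl

theorem IsSegment.end_mem (hp : T.IsSegment A u v p) : .vert v ∈ A :=
  hp.2.2 ▸ hp.1.pathCells_vert_last

theorem IsSegment.isDiCycle (hp : T.IsSegment A u u' p) (hq : T.IsSegment B v v' q)
    (hAB : Disjoint A B) (hb : T.IsBridge X u' v b) (hb' : T.IsBridge Y v' u b') :
    T.dual.IsDiCycle T.pos (p ++ b :: q ++ [b']) := by
  obtain ⟨hp, hpn, rfl⟩ := hp
  obtain ⟨hq, hqn, rfl⟩ := hq
  obtain ⟨hbP, -, rfl, rfl⟩ := hb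
  obtain ⟨hbP', -, rfl, rfl⟩ := hb'
  refine ⟨by simp, ⟨_, CMap.isDiPath_append.2 ⟨_, CMap.isDiPath_append.2
    ⟨_, hp, hbP, rfl, hq⟩, hbP', rfl, rfl⟩⟩, ?_⟩
  have htails : (p ++ b :: q ++ [b']).map T.dual.tail =
      (p.map T.dual.tail ++ [T.dual.tail b]) ++ (q.map T.dual.tail ++ [T.dual.tail b']) := by simp
  rw [htails, hp.map_tail_append, hq.map_tail_append, List.nodup_append]
  refine ⟨hpn, hqn, fun x hx y hy hxy => ?_⟩
  exact Set.disjoint_left.1 hAB (CMap.vert_mem_pathCells.2 hx)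
    (CMap.vert_mem_pathCells.2 (hxy ▸ hy))

end Bridges

section PolarSegments

variable {core circle before after A X : Set T.dual.Cell} {u v : T.dual.Vertex} {p : List D}
  {a c : D}

/-- The part of a dual core on a polar circle is a segment `p`, which is preceded on the circle by
the single edge of the meridian dual `before` and followed by the single edge of `after`; so the
circle has at least two edges off the segment. -/
structure IsPolarSegment (core circle before after : Set T.dual.Cell) (u v : T.dual.Vertex)
    (p : List D) : Prop where
  segment : T.IsSegment (core ∩ circle) u v p
  exists_flanks : ∃ a c, before ∩ circle = {.edge (T.dual.edge a)} ∧
    after ∩ circle = {.edge (T.dual.edge c)} ∧ T.dual.edge a ≠ T.dual.edge c ∧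
    T.dual.IsDiPath T.pos (T.dual.tail a) (T.dual.head c) (a :: p ++ [c]) ∧
    T.dual.head a = u ∧ T.dual.tail c = v
  length_add_two_le : p.length + 2 ≤ T.edgeLength circle

variable {T}

theorem IsSegment.length_add_two_le [Finite D] (hp : T.IsSegment (A ∩ X) (T.dual.head a) v p)
    (ha : a ∈ T.pos) (haX : .edge (T.dual.edge a) ∈ X) (hc : c ∈ T.pos)
    (hcX : .edge (T.dual.edge c) ∈ X) (hcA : .vert (T.dual.head c) ∉ A) :
    p.length + 2 ≤ T.edgeLength X := by
  obtain ⟨hpath, hnodup, hcells⟩ := hp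
  have hvert : ∀ w ∈ T.dual.head a :: p.map T.dual.head, .vert w ∈ A := fun w hw =>
    (hcells ▸ CMap.vert_mem_pathCells.2 hw : CMap.Cell.vert w ∈ A ∩ X).1
  have hedge : ∀ d ∈ p, .edge (T.dual.edge d) ∈ X := fun d hd =>
    (hcells ▸ CMap.edge_mem_pathCells.2 (Or.inl hd) : CMap.Cell.edge (T.dual.edge d) ∈ A ∩ X).2
  have hnodup' : ((a :: p ++ [c]).map T.dual.head).Nodup := by
    rw [List.map_append, List.map_cons]
    refine hnodup.append (List.nodup_singleton _) (List.disjoint_singleton.2 ?_)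
    exact fun h => hcA (hvert _ h)
  have hall : ∀ d ∈ a :: p ++ [c], d ∈ T.pos ∧ .edge (T.dual.edge d) ∈ X := by
    simp only [List.cons_append, List.mem_cons, List.mem_append, List.not_mem_nil, or_false]
    rintro d (rfl | h | rfl)
    · exact ⟨ha, haX⟩
    · exact ⟨hpath.mem h, hedge d h⟩
    · exact ⟨hc, hcX⟩
  have hlen : (a :: p ++ [c]).length ≤ T.edgeLength X :=
    CMap.IsOrientation.length_le_ncard (M := T.dual) T.orientation hnodup'.of_map
      (fun d hd => (hall d hd).1) fun d hd => (hall d hd).2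
  rwa [List.length_append, List.length_cons] at hlen

theorem IsPolarSegment.of_reverse [Finite D]
    (h : T.reverse.IsPolarSegment core circle before after u v p) :
    T.IsPolarSegment core circle after before v u (p.map T.α).reverse := by
  have hpos : T.dual.α ⁻¹' T.reverse.pos = T.pos := Set.ext fun d => CMap.α_mem_preimage_α
  obtain ⟨⟨hpath, hnodup, hcells⟩, ⟨a, c, ha, hc, hac, hflank, rfl, rfl⟩, hlen⟩ := h
  refine ⟨⟨hpos ▸ hpath.reverse, ?_, ?_⟩, ⟨T.α c, T.α a, ?_, ?_, ?_, ?_, ?_, ?_⟩, ?_⟩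
  · exact hpath.cons_map_head_reverse ▸ List.nodup_reverse.2 hnodup
  · exact hpath.pathCells_reverse.trans hcells
  · exact hc.trans (congrArg (fun e => {CMap.Cell.edge e}) (T.dual.edge_α c).symm)
  · exact ha.trans (congrArg (fun e => {CMap.Cell.edge e}) (T.dual.edge_α a).symm)
  · exact fun h => hac (((T.dual.edge_α a).symm.trans h.symm).trans (T.dual.edge_α c))
  · have hmap : T.α c :: (p.map T.α).reverse ++ [T.α a] =
        ((a :: p ++ [c]).map T.α).reverse := by simp
    have hhead : T.dual.head (T.α a) = T.dual.tail a := T.dual.head_α a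
    rw [hmap, hhead]
    exact hpos ▸ hflank.reverse
  · exact T.dual.head_α c
  · rfl
  · rw [List.length_reverse, List.length_map]
    exact hlen

variable (T) [Finite D]

theorem exists_isSegment_N : ∃ p, T.IsSegment (T.coreW ∩ T.circleN) T.wm0 T.wm1 p := by
  set a := T.WE.head T.WE_ne
  set c := T.EW.head T.EW_ne
  have haN : T.tail a = T.N := T.WE_path.tail_head _
  have horb : ∀ d, T.σ⁻¹.SameCycle a d ↔ T.tail d = T.N := fun d => by
    rw [Equiv.Perm.sameCycle_inv, ← T.tail_eq_tail_iff, haN, eq_comm]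
  have hinv : ∀ d, T.tail (T.σ⁻¹ d) = T.tail d := fun d => by
    rw [← T.tail_σ, Equiv.Perm.inv_def, Equiv.apply_symm_apply]
  have hface : ∀ f : T.Face, (CMap.Cell.vert f : T.dual.Cell) ∈ T.coreW ↔ .face f ∈ T.W :=
    fun f => CMap.vert_mem_dualCell_image
  have hedge : ∀ d, (CMap.Cell.edge (T.dual.edge d) : T.dual.Cell) ∈ T.coreW ↔
      .edge (T.edge d) ∈ T.W := fun d => CMap.edge_mem_dualCell_image
  have hmer : ∀ d, d ∈ T.WE ∨ d ∈ T.EW → (CMap.Cell.edge (T.dual.edge d) : T.dual.Cell) ∉ T.coreW :=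
    fun d hd h => T.notMem_meridians_of_mem_W ((hedge d).1 h)
      (T.edge_mem_meridians.2 (hd.imp Or.inl Or.inl))
  obtain ⟨p, hpath, hnodup, hcells⟩ := CMap.exists_isDiPath_pathCells_eq_inter (M := T.dual)
    (τ := T.σ⁻¹) (P := T.pos) (C := T.coreW) (a := a) (c := c) T.right_eq_left_σ_inv
    (fun d hd => by_contra fun h => T.bipolar.head_ne (T.α_mem_pos h)
      ((T.head_α d).trans ((horb d).1 hd)))
    (fun d hd d' hd' h => T.σ⁻¹.injective <| T.regular.face_simple _ _
      (by rwa [← T.right_eq_left_σ_inv, ← T.right_eq_left_σ_inv])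
      (by rw [hinv, hinv, (horb d).1 hd, (horb d').1 hd']))
    ((horb c).2 (T.EW_path.tail_head _)) ((hface _).2 T.NE_mem_W)
    (fun h => T.notMem_E ((hface _).1 h) (T.right_mem_E (List.head_mem _)))
    (hmer a (Or.inl (List.head_mem _))) (hmer c (Or.inr (List.head_mem _)))
    (fun d hd hda hdc => by
      have hd' : .edge (T.edge d) ∉ T.meridians := fun h =>
        (T.eq_head_of_tail_eq_N ((horb d).1 hd) h).elim hda hdc
      exact ⟨(hedge d).trans ((T.edge_mem_W_iff_left hd').trans (hface _).symm),
        (hedge d).trans ((T.edge_mem_W_iff_right hd').trans (hface _).symm)⟩)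
  refine ⟨p, hpath, hnodup, ?_⟩
  rw [circleN, CMap.faceBoundary_dualFace]
  simp only [horb] at hcells
  exact hcells

theorem exists_isPolarSegment_N :
    ∃ p, T.IsPolarSegment T.coreW T.circleN T.dualWE T.dualEW T.wm0 T.wm1 p := by
  obtain ⟨p, hp⟩ := T.exists_isSegment_N
  have ha : T.WE.head T.WE_ne ∈ T.WE := List.head_mem _
  have hc : T.EW.head T.EW_ne ∈ T.EW := List.head_mem _
  have haN := T.WE_path.tail_head T.WE_ne
  have hcN := T.EW_path.tail_head T.EW_ne
  refine ⟨p, hp, ⟨_, _, T.meridianDual_inter_circleN T.WE_path T.WE_ne,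
    T.meridianDual_inter_circleN T.EW_path T.EW_ne, T.edge_ne_of_mem ha hc,
    CMap.isDiPath_append.2
      ⟨_, ⟨T.WE_path.mem ha, rfl, hp.1⟩, T.EW_path.mem hc, rfl, rfl⟩, rfl, rfl⟩,
    hp.length_add_two_le (T.WE_path.mem ha)
      (CMap.edge_mem_faceBoundary_dualFace.2 (Or.inl haN)) (T.EW_path.mem hc)
      (CMap.edge_mem_faceBoundary_dualFace.2 (Or.inl hcN)) fun h => ?_⟩
  exact T.notMem_E (CMap.vert_mem_dualCell_image.1 h) (T.right_mem_E hc)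

theorem exists_isPolarSegment_S :
    ∃ q, T.IsPolarSegment T.coreE T.circleS T.dualEW T.dualWE T.wp0 T.wp1 q := by
  obtain ⟨p, hp⟩ := T.reverse.exists_isPolarSegment_N
  have hwp0 : T.reverse.wm1 = T.wp0 := T.reverse_NW
  have hwp1 : T.reverse.wm0 = T.wp1 := T.reverse_NE
  rw [T.reverse_coreW, T.reverse_dualWE, T.reverse_dualEW, hwp0, hwp1] at hp
  exact ⟨_, hp.of_reverse⟩

end PolarSegments

end ThreeCellTemplate
theorem corollary5p2 {D : Type*} [Finite D] (T : ThreeCellTemplate D) :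
    -- (i) shared edges of the polar circles
    ((∃ e, .edge e ∈ T.circleN ∩ T.circleS) ↔ T.skeleton.dist T.N T.S = 1) ∧
    -- (ii) the core poles, and singleton cores
    (T.IsCoreBipolar T.coreW T.wm0 T.wm1 ∧
      (T.wm0 = T.wm1 ↔ T.coreW = {.vert T.wm0} ∧ T.coreW = {.vert T.wm1})) ∧
    (T.IsCoreBipolar T.coreE T.wp0 T.wp1 ∧
      (T.wp0 = T.wp1 ↔ T.coreE = {.vert T.wp0} ∧ T.coreE = {.vert T.wp1})) ∧
    -- (iii) distance of the polar circles, and polar bridges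
    (T.edgeDist T.circleN T.circleS ≤ 1 ∧
      .vert T.wm0 ∈ T.circleN ∧ .vert T.wm1 ∈ T.circleN ∧
      .vert T.wp0 ∈ T.circleS ∧ .vert T.wp1 ∈ T.circleS ∧
      ∃ b b', T.IsBridge T.dualEW T.wm1 T.wp0 b ∧ T.IsBridge T.dualWE T.wp1 T.wm0 b' ∧
        T.dual.edge b ≠ T.dual.edge b') ∧
    -- the polar segments `p` from `w₋⁰` to `w₋¹` and `q` from `w₊⁰` to `w₊¹`
    ∃ p q : List D,
      T.IsSegment (T.coreW ∩ T.circleN) T.wm0 T.wm1 p ∧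
      T.IsSegment (T.coreE ∩ T.circleS) T.wp0 T.wp1 q ∧
      -- (iv) they are disjoint, and close up with the bridges to a directed cycle
      Disjoint (T.dual.pathCells T.wm0 p) (T.dual.pathCells T.wp0 q) ∧
      (∀ b b', T.IsBridge T.dualEW T.wm1 T.wp0 b → T.IsBridge T.dualWE T.wp1 T.wm0 b' →
        T.dual.IsDiCycle T.pos (p ++ b :: q ++ [b'])) ∧
      -- (v) the edges which precede and follow the segments on the polar circles
      (∃ a c, T.dualWE ∩ T.circleN = {.edge (T.dual.edge a)} ∧
        T.dualEW ∩ T.circleN = {.edge (T.dual.edge c)} ∧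
        T.dual.edge a ≠ T.dual.edge c ∧
        T.dual.IsDiPath T.pos (T.dual.tail a) (T.dual.head c) (a :: p ++ [c]) ∧
        T.dual.head a = T.wm0 ∧ T.dual.tail c = T.wm1) ∧
      (∃ a c, T.dualEW ∩ T.circleS = {.edge (T.dual.edge a)} ∧
        T.dualWE ∩ T.circleS = {.edge (T.dual.edge c)} ∧
        T.dual.edge a ≠ T.dual.edge c ∧
        T.dual.IsDiPath T.pos (T.dual.tail a) (T.dual.head c) (a :: q ++ [c]) ∧
        T.dual.head a = T.wp0 ∧ T.dual.tail c = T.wp1) ∧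
      -- (vi) lengths
      p.length + 2 ≤ T.edgeLength T.circleN ∧
      q.length + 2 ≤ T.edgeLength T.circleS := by
  obtain ⟨b, hbEW, hb⟩ := T.exists_isBridge_EW
  obtain ⟨b', hbWE, hb'⟩ := T.exists_isBridge_WE
  obtain ⟨p, hp⟩ := T.exists_isPolarSegment_N
  obtain ⟨q, hq⟩ := T.exists_isPolarSegment_S
  have hwm0 := hp.segment.start_mem.2
  have hwm1 := hp.segment.end_mem.2
  have hwp0 := hq.segment.start_mem.2
  have hwp1 := hq.segment.end_mem.2
  have hdisj : Disjoint (T.coreW ∩ T.circleN) (T.coreE ∩ T.circleS) :=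
    T.disjoint_cores.mono Set.inter_subset_left Set.inter_subset_left
  exact ⟨T.exists_shared_edge_iff,
    ⟨T.isCoreBipolar_W, T.poles_eq_iff T.NE_mem_W T.isCoreBipolar_W⟩,
    ⟨T.isCoreBipolar_E, T.poles_eq_iff T.SE_mem_E T.isCoreBipolar_E⟩,
    ⟨hb.edgeDist_le_one hwm1 hwp0, hwm0, hwm1, hwp0, hwp1,
      b, b', hb, hb', (T.edge_ne_of_mem hbWE hbEW).symm⟩,
    p, q, hp.segment, hq.segment, hp.segment.2.2.symm ▸ hq.segment.2.2.symm ▸ hdisj,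
    fun _ _ hb hb' => hp.segment.isDiCycle hq.segment hdisj hb hb',
    hp.exists_flanks, hq.exists_flanks, hp.length_add_two_le, hq.length_add_two_le⟩
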